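/- A \emph{semifield} is a set $\mathbb F$ with a commutative and associative addition and a multiplication that makes $\mathbb F$ an abelian group and distributes over the addition (there is no zero). Let $n\ge 1$ be an integer and $L=\{(x,y,t)\in\mathbb Z^3 : x+y+t\equiv n \bmod 2\}$. For $S\subset\mathbb R^3$ let $\mathcal H(S)=\mathbb F^{S\cap L}$ be the set of states of $S$, and let $P\mathcal H(S)=\mathcal H(S)/\mathbb F^\times$ be its quotient by the scaling action of $\mathbb F^\times=(\mathbb F,\cdot)$. For space-time $Y=I\times J\times\mathbb R$, with $I,J\subset\mathbb R$ closed intervals, the bounded octahedron recurrence is the rule $f(x,y,t+1)f(x,y,t-1)=N$, where $N=f(x+1,y,t)f(x-1,y,t)+f(x,y+1,t)f(x,y-1,t)$ if $x$ is interior to $I$ and $y$ is interior to $J$; $N=f(x+1,y,t)f(x-1,y,t)$ if $x$ is interior to $I$ and $y$ is an endpoint of $J$; $N=f(x,y+1,t)f(x,y-1,t)$ if $x$ is an endpoint of $I$ and $y$ is interior to $J$; and $N=f(x+\sigma,y,t)f(x,y+\tau,t)$ if both are endpoints, where $\sigma,\tau\in\{1,-1\}$ are the directions pointing into $I$ and $J$.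 Let $$A_1=\{(x,y,t)\in\mathbb R\times\mathbb R_{\ge0}\times\mathbb R : |x|+|y|+|t|\le n\},$$ $$A_2=\{(x,y,t)\in\mathbb R_{\ge0}\times[0,n]\times\mathbb R : x+y-n\le t\le y-x+n\},$$ with the recurrences of $Y_1=\mathbb R\times\mathbb R_{\ge0}\times\mathbb R$ and $Y_2=\mathbb R_{\ge0}\times[0,n]\times\mathbb R$ respectively. Their lower boundaries $S_i$ and upper boundaries $S_i'$ are $$S_1=\mathrm{conv}\{(n,0,0),(0,n,0),(0,0,-n)\}\cup\mathrm{conv}\{(-n,0,0),(0,n,0),(0,0,-n)\},$$ $$S_1'=\mathrm{conv}\{(n,0,0),(0,n,0),(0,0,n)\}\cup\mathrm{conv}\{(-n,0,0),(0,n,0),(0,0,n)\},$$ $$S_2=\mathrm{conv}\{(0,0,-n),(n,0,0),(0,n,0),(n,n,n)\},\qquad S_2'=\mathrm{conv}\{(n,0,0),(0,0,n),(n,n,n),(0,n,2n)\}.$$ Every state of $S_i$ extends uniquely to a solution of the recurrence on $A_i\cap L$; restricting this solution to $S_i'$ gives $\phi_i:\mathcal H(S_i)\to\mathcal H(S_i')$,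 which commutes with scaling and so induces $\overline\phi_i:P\mathcal H(S_i)\to P\mathcal H(S_i')$. Let $s:S_1\to S_2$ and $s':S_1'\to S_2'$ be the bijections that are affine on each of the two triangles of $S_1$, respectively $S_1'$, with $$s:\ (n,0,0)\mapsto(n,n,n),\ (0,n,0)\mapsto(0,n,0),\ (0,0,-n)\mapsto(n,0,0),\ (-n,0,0)\mapsto(0,0,-n),$$ $$s':\ (n,0,0)\mapsto(0,n,2n),\ (0,n,0)\mapsto(0,0,n),\ (0,0,n)\mapsto(n,n,n),\ (-n,0,0)\mapsto(n,0,0).$$ They send points of $L$ to points of $L$, and so induce pullbacks $s^*:P\mathcal H(S_2)\to P\mathcal H(S_1)$ and $s'^*:P\mathcal H(S_2')\to P\mathcal H(S_1')$. \textbf{Proposition.} For every semifield $\mathbb F$ and every integer $n\ge1$, the recurrences in $A_1$ and $A_2$ are equivalent up to scaling, in the sense that $$s'^*\circ\overline\phi_2=\overline\phi_1\circ s^*$$ as maps $P\mathcal H(S_2)\to P\mathcal H(S_1')$. -/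

import Mathlib

namespace OctRec

/-- A semifield in the sense of a set with a commutative and associative addition (without zero)
and a multiplication that makes it an abelian group and distributes over the addition. -/
class PosSemifield (F : Type*) extends CommGroup F, AddCommSemigroup F, Distrib F

/-! ### States and the bounded octahedron recurrence -/

/-- The points of `ℤ³` whose coordinate sum is congruent to `n` modulo `2`. -/
def lattice (n : ℤ) : Set (ℝ × ℝ × ℝ) :=
  {p | ∃ x y t : ℤ, p = ((x : ℝ), (y : ℝ), (t : ℝ)) ∧ Even (x + y + t - n)}

/-- The set `𝓗(A) = F ^ (A ∩ L)` of states of a subset `A` of space-time. -/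
abbrev State (n : ℤ) (A : Set (ℝ × ℝ × ℝ)) (F : Type*) : Type _ :=
  ↥(A ∩ lattice n) → F

/-- The projectivized states `P𝓗(A)`: the quotient of `𝓗(A)` by the scaling action of the
multiplicative group of `F`. -/
abbrev ProjState (n : ℤ) (A : Set (ℝ × ℝ × ℝ)) (F : Type*) [PosSemifield F] : Type _ :=
  MulAction.orbitRel.Quotient F (State n A F)

/-- Restriction of a state to a smaller subset. -/
def restrict {n : ℤ} {S A : Set (ℝ × ℝ × ℝ)} {F : Type*} (h : S ⊆ A) (f : State n A F) :
    State n S F :=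
  fun p => f ⟨p.1, h p.2.1, p.2.2⟩

/-- `f` satisfies the bounded octahedron recurrence in the subset `A` of the space-time
`Y = I × J × ℝ`, where `I` and `J` are intervals. There is one rule for the interior of the space
`I × J`, one rule for each kind of wall, and one for the corners, where `σ` and `τ` are the
directions that point from the corner into the space. The rules apply whenever all
the points that occur in them are lattice points of `A`. -/
structure IsRecurrent {F : Type*} [PosSemifield F] (n : ℤ) (I J : Set ℝ)
    (A : Set (ℝ × ℝ × ℝ)) (f : State n A F) : Prop where
  inner : ∀ x y t : ℝ, x ∈ interior I → y ∈ interior J →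
    ∀ (hu : (x, y, t + 1) ∈ A ∩ lattice n) (hd : (x, y, t - 1) ∈ A ∩ lattice n)
      (hx : (x + 1, y, t) ∈ A ∩ lattice n) (hx' : (x - 1, y, t) ∈ A ∩ lattice n)
      (hy : (x, y + 1, t) ∈ A ∩ lattice n) (hy' : (x, y - 1, t) ∈ A ∩ lattice n),
      f ⟨_, hu⟩ = (f ⟨_, hx⟩ * f ⟨_, hx'⟩ + f ⟨_, hy⟩ * f ⟨_, hy'⟩) / f ⟨_, hd⟩
  wall_y : ∀ x y t : ℝ, x ∈ interior I → y ∈ J \ interior J →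
    ∀ (hu : (x, y, t + 1) ∈ A ∩ lattice n) (hd : (x, y, t - 1) ∈ A ∩ lattice n)
      (hx : (x + 1, y, t) ∈ A ∩ lattice n) (hx' : (x - 1, y, t) ∈ A ∩ lattice n),
      f ⟨_, hu⟩ = f ⟨_, hx⟩ * f ⟨_, hx'⟩ / f ⟨_, hd⟩
  wall_x : ∀ x y t : ℝ, x ∈ I \ interior I → y ∈ interior J →
    ∀ (hu : (x, y, t + 1) ∈ A ∩ lattice n) (hd : (x, y, t - 1) ∈ A ∩ lattice n)
      (hy : (x, y + 1, t) ∈ A ∩ lattice n) (hy' : (x, y - 1, t) ∈ A ∩ lattice n),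
      f ⟨_, hu⟩ = f ⟨_, hy⟩ * f ⟨_, hy'⟩ / f ⟨_, hd⟩
  corner : ∀ x y t σ τ : ℝ, x ∈ I \ interior I → y ∈ J \ interior J →
    (σ = 1 ∨ σ = -1) → (τ = 1 ∨ τ = -1) → x + σ ∈ I → y + τ ∈ J →
    ∀ (hu : (x, y, t + 1) ∈ A ∩ lattice n) (hd : (x, y, t - 1) ∈ A ∩ lattice n)
      (hx : (x + σ, y, t) ∈ A ∩ lattice n) (hy : (x, y + τ, t) ∈ A ∩ lattice n),
      f ⟨_, hu⟩ = f ⟨_, hx⟩ * f ⟨_, hy⟩ / f ⟨_, hd⟩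

/-- Every state of `S` extends to exactly one solution of the recurrence in `A`. -/
def WellPosed (n : ℤ) (I J : Set ℝ) {A S : Set (ℝ × ℝ × ℝ)} (hS : S ⊆ A)
    (F : Type*) [PosSemifield F] : Prop :=
  ∀ g : State n S F, ∃! f : State n A F, IsRecurrent n I J A f ∧ restrict hS f = g

/-- The map `𝓗(S) → 𝓗(S')` induced by the recurrence in `A`: extend the state to `A` and
restrict it to `S'`. -/
noncomputable def evolution {n : ℤ} {I J : Set ℝ} {A S S' : Set (ℝ × ℝ × ℝ)} {hS : S ⊆ A}
    (hS' : S' ⊆ A) {F : Type*} [PosSemifield F] (h : WellPosed n I J hS F)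
    (g : State n S F) : State n S' F :=
  restrict hS' (h g).choose

theorem IsRecurrent.smul {F : Type*} [PosSemifield F] {n : ℤ} {I J : Set ℝ}
    {A : Set (ℝ × ℝ × ℝ)} {f : State n A F} (hf : IsRecurrent n I J A f) (c : F) :
    IsRecurrent n I J A (c • f) := by
  have key : ∀ a b e : F, c * (a * b / e) = (c * a) * (c * b) / (c * e) := by
    intro a b e
    rw [eq_div_iff_mul_eq', mul_mul_mul_comm, div_mul_cancel, mul_mul_mul_comm]
  have key2 : ∀ a b a' b' e : F, c * ((a * b + a' * b') / e) =
      ((c * a) * (c * b) + (c * a') * (c * b')) / (c * e) := by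
    intro a b a' b' e
    rw [eq_div_iff_mul_eq', mul_mul_mul_comm, div_mul_cancel, mul_mul_mul_comm c a,
      mul_mul_mul_comm c a', mul_add]
  refine ⟨?_, ?_, ?_, ?_⟩
  · intro x y t hI hJ hu hd hx hx' hy hy'
    simp only [Pi.smul_apply, smul_eq_mul, hf.inner x y t hI hJ hu hd hx hx' hy hy', key2]
  · intro x y t hI hJ hu hd hx hx'
    simp only [Pi.smul_apply, smul_eq_mul, hf.wall_y x y t hI hJ hu hd hx hx', key]
  · intro x y t hI hJ hu hd hy hy'
    simp only [Pi.smul_apply, smul_eq_mul, hf.wall_x x y t hI hJ hu hd hy hy', key]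
  · intro x y t σ τ hI hJ hσ hτ hxI hyJ hu hd hx hy
    simp only [Pi.smul_apply, smul_eq_mul,
      hf.corner x y t σ τ hI hJ hσ hτ hxI hyJ hu hd hx hy, key]

theorem evolution_smul {n : ℤ} {I J : Set ℝ} {A S S' : Set (ℝ × ℝ × ℝ)} {hS : S ⊆ A}
    (hS' : S' ⊆ A) {F : Type*} [PosSemifield F] (h : WellPosed n I J hS F)
    (c : F) (g : State n S F) : evolution hS' h (c • g) = c • evolution hS' h g := by
  have h1 := (h g).choose_spec.1
  have h2 : c • (h g).choose = (h (c • g)).choose := by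
    refine (h (c • g)).choose_spec.2 _ ⟨h1.1.smul c, ?_⟩
    funext p
    exact congrArg (fun a => c * a) (congrFun h1.2 p)
  unfold evolution
  rw [← h2]
  rfl

/-- The map `P𝓗(S) → P𝓗(S')` induced by the recurrence in `A`. -/
noncomputable def projEvolution {n : ℤ} {I J : Set ℝ} {A S S' : Set (ℝ × ℝ × ℝ)} {hS : S ⊆ A}
    (hS' : S' ⊆ A) {F : Type*} [PosSemifield F] (h : WellPosed n I J hS F) :
    ProjState n S F → ProjState n S' F :=
  Quotient.map (evolution hS' h) (by
    rintro a b ⟨c, hc⟩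
    exact ⟨c, by rw [← hc]; exact (evolution_smul hS' h c b).symm⟩)

/-- The pullback of states `𝓗(T) → 𝓗(S)` along a map `s : S → T` that sends lattice points
to lattice points. -/
def pullback {n : ℤ} {S T : Set (ℝ × ℝ × ℝ)} {F : Type*} (s : S → T)
    (hs : ∀ p : S, (p : ℝ × ℝ × ℝ) ∈ lattice n → (s p : ℝ × ℝ × ℝ) ∈ lattice n)
    (g : State n T F) : State n S F :=
  fun p => g ⟨s ⟨p.1, p.2.1⟩, (s ⟨p.1, p.2.1⟩).2, hs ⟨p.1, p.2.1⟩ p.2.2⟩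

/-- The pullback `P𝓗(T) → P𝓗(S)` of projectivized states. -/
def projPullback {n : ℤ} {S T : Set (ℝ × ℝ × ℝ)} {F : Type*} [PosSemifield F] (s : S → T)
    (hs : ∀ p : S, (p : ℝ × ℝ × ℝ) ∈ lattice n → (s p : ℝ × ℝ × ℝ) ∈ lattice n) :
    ProjState n T F → ProjState n S F :=
  Quotient.map (pullback s hs) (by
    rintro a b ⟨c, hc⟩
    exact ⟨c, by rw [← hc]; rfl⟩)

/-! ### Existence and uniqueness of solutions (auxiliary) -/

theorem lattice_shift {n : ℤ} {x y t : ℝ} (h : (x, y, t) ∈ lattice n) (a b c : ℤ)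
    (he : Even (a + b + c)) : (x + a, y + b, t + c) ∈ lattice n := by
  obtain ⟨i, j, k, hp, hev⟩ := h
  simp only [Prod.mk.injEq] at hp
  obtain ⟨rfl, rfl, rfl⟩ := hp
  refine ⟨i + a, j + b, k + c, by push_cast; rfl, ?_⟩
  rw [Int.even_iff] at *
  omega

/-- The right hand side of the recurrence, in terms of the two previous time slices. -/
noncomputable def ruleAux {F : Type*} [PosSemifield F] (I J : Set ℝ) (cur prev : ℝ → ℝ → F)
    (x y : ℝ) : F := by
  classical exact
    (if x ∈ interior I then
      if y ∈ interior J then cur (x + 1) y * cur (x - 1) y + cur x (y + 1) * cur x (y - 1)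
      else cur (x + 1) y * cur (x - 1) y
    else
      if y ∈ interior J then cur x (y + 1) * cur x (y - 1)
      else cur (if x + 1 ∈ I then x + 1 else x - 1) y *
        cur x (if y + 1 ∈ J then y + 1 else y - 1)) / prev x y

/-- The values of a solution at the times `k - n`, for natural numbers `k`. -/
noncomputable def sliceAux {F : Type*} [PosSemifield F] (n : ℤ) (I J : Set ℝ)
    (S : Set (ℝ × ℝ × ℝ)) (g : State n S F) : ℕ → ℝ → ℝ → F := by
  classical exact fun k => match k with
  | 0 => fun x y => if h : (x, y, ((0 : ℕ) : ℝ) - n) ∈ S ∩ lattice n then g ⟨_, h⟩ else 1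
  | 1 => fun x y => if h : (x, y, ((1 : ℕ) : ℝ) - n) ∈ S ∩ lattice n then g ⟨_, h⟩ else 1
  | (k + 2) => fun x y =>
      if h : (x, y, ((k + 2 : ℕ) : ℝ) - n) ∈ S ∩ lattice n then g ⟨_, h⟩ else
        ruleAux I J (sliceAux n I J S g (k + 1)) (sliceAux n I J S g k) x y

theorem sliceAux_of_mem {F : Type*} [PosSemifield F] (n : ℤ) (I J : Set ℝ)
    (S : Set (ℝ × ℝ × ℝ)) (g : State n S F) (k : ℕ) (x y : ℝ)
    (h : (x, y, (k : ℝ) - n) ∈ S ∩ lattice n) : sliceAux n I J S g k x y = g ⟨_, h⟩ := by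
  match k, h with
  | 0, h => rw [sliceAux]; exact dif_pos h
  | 1, h => rw [sliceAux]; exact dif_pos h
  | (k + 2), h => rw [sliceAux]; exact dif_pos h

theorem sliceAux_of_not_mem {F : Type*} [PosSemifield F] (n : ℤ) (I J : Set ℝ)
    (S : Set (ℝ × ℝ × ℝ)) (g : State n S F) (k : ℕ) (x y : ℝ)
    (h : (x, y, ((k + 2 : ℕ) : ℝ) - n) ∉ S ∩ lattice n) :
    sliceAux n I J S g (k + 2) x y =
      ruleAux I J (sliceAux n I J S g (k + 1)) (sliceAux n I J S g k) x y := by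
  rw [sliceAux]; exact dif_neg h

theorem mem_interior_of_neighbours {I : Set ℝ} (hI : I.OrdConnected) {x : ℝ}
    (h1 : x + 1 ∈ I) (h2 : x - 1 ∈ I) : x ∈ interior I := by
  rw [mem_interior_iff_mem_nhds]
  exact Filter.mem_of_superset (Icc_mem_nhds (by linarith) (by linarith)) (hI.out h2 h1)

theorem wellPosed_of {n : ℤ} {I J : Set ℝ} {A S : Set (ℝ × ℝ × ℝ)} (hS : S ⊆ A)
    (hI : I.OrdConnected) (hJ : J.OrdConnected)
    (hY : ∀ x y t : ℝ, (x, y, t) ∈ A → x ∈ I ∧ y ∈ J)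
    (hlow : ∀ x y t : ℝ, (x, y, t) ∈ A → -(n : ℝ) ≤ t)
    (hbot : ∀ x y t : ℝ, (x, y, t - 1) ∈ A → (x, y, t + 1) ∉ S)
    (hstep : ∀ x y t : ℝ, (x, y, t + 1) ∈ A ∩ lattice n → (x, y, t + 1) ∉ S →
      (x, y, t - 1) ∈ A ∧
      (x ∈ interior I → (x + 1, y, t) ∈ A ∧ (x - 1, y, t) ∈ A) ∧
      (x ∉ interior I → (x + 1, y, t) ∈ A ∨ (x - 1, y, t) ∈ A) ∧
      (y ∈ interior J → (x, y + 1, t) ∈ A ∧ (x, y - 1, t) ∈ A) ∧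
      (y ∉ interior J → (x, y + 1, t) ∈ A ∨ (x, y - 1, t) ∈ A))
    (F : Type*) [PosSemifield F] : WellPosed n I J hS F := by
  classical
  intro g
  have hfloor : ∀ k : ℕ, ⌊(k : ℝ) - n + n⌋₊ = k := fun k => by
    rw [sub_add_cancel, Nat.floor_natCast]
  have htime : ∀ x y t : ℝ, (x, y, t) ∈ A ∩ lattice n → ∃ k : ℕ, t = (k : ℝ) - n := by
    rintro x y t ⟨hA, i, j, k, hp, -⟩
    simp only [Prod.mk.injEq] at hp
    obtain ⟨rfl, rfl, rfl⟩ := hp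
    have := hlow _ _ _ hA
    have h0 : 0 ≤ k + n := by
      have : (0 : ℝ) ≤ ((k + n : ℤ) : ℝ) := by push_cast; linarith
      exact_mod_cast this
    refine ⟨(k + n).toNat, ?_⟩
    have : (((k + n).toNat : ℤ) : ℝ) = ((k + n : ℤ) : ℝ) := by rw [Int.toNat_of_nonneg h0]
    rw [Int.cast_natCast] at this
    rw [this]; push_cast; ring
  have hex : ∃ f : State n A F, IsRecurrent n I J A f ∧ restrict hS f = g := by
   refine ⟨fun p => sliceAux n I J S g ⌊p.1.2.2 + n⌋₊ p.1.1 p.1.2.1, ?_, ?_⟩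
   · have main : ∀ x y t : ℝ, (x, y, t + 1) ∈ A ∩ lattice n → (x, y, t - 1) ∈ A ∩ lattice n →
         sliceAux n I J S g ⌊t + 1 + n⌋₊ x y =
         ruleAux I J (sliceAux n I J S g ⌊t + n⌋₊) (sliceAux n I J S g ⌊t - 1 + n⌋₊) x y := by
       intro x y t hu hd
       obtain ⟨k, hk⟩ := htime _ _ _ hd
       have e1 : ⌊t - 1 + n⌋₊ = k := by rw [hk, hfloor]
       have e2 : ⌊t + n⌋₊ = k + 1 := by
         rw [← hfloor (k + 1)]; congr 1; push_cast; linarith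
       have e3 : ⌊t + 1 + n⌋₊ = k + 2 := by
         rw [← hfloor (k + 2)]; congr 1; push_cast; linarith
       rw [e1, e2, e3]
       apply sliceAux_of_not_mem
       intro h
       refine hbot x y t hd.1 ?_
       have : ((k + 2 : ℕ) : ℝ) - n = t + 1 := by push_cast; linarith
       rw [← this]
       exact h.1
     refine ⟨?_, ?_, ?_, ?_⟩
     · intro x y t hxI hyJ hu hd hx hx' hy hy'
       simp only [main x y t hu hd, ruleAux, if_pos hxI, if_pos hyJ]
     · intro x y t hxI hyJ hu hd hx hx'
       simp only [main x y t hu hd, ruleAux, if_pos hxI, if_neg hyJ.2]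
     · intro x y t hxI hyJ hu hd hy hy'
       simp only [main x y t hu hd, ruleAux, if_neg hxI.2, if_pos hyJ]
     · intro x y t σ τ hxI hyJ hσ hτ hσI hτJ hu hd hx hy
       have ex : (if x + 1 ∈ I then x + 1 else x - 1) = x + σ := by
         rcases hσ with rfl | rfl
         · rw [if_pos hσI]
         · rw [if_neg, sub_eq_add_neg]
           intro h
           exact hxI.2 (mem_interior_of_neighbours hI h (by rwa [sub_eq_add_neg]))
       have ey : (if y + 1 ∈ J then y + 1 else y - 1) = y + τ := by
         rcases hτ with rfl | rfl
         · rw [if_pos hτJ]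
         · rw [if_neg, sub_eq_add_neg]
           intro h
           exact hyJ.2 (mem_interior_of_neighbours hJ h (by rwa [sub_eq_add_neg]))
       simp only [main x y t hu hd, ruleAux, if_neg hxI.2, if_neg hyJ.2, ex, ey]
   · funext p
     obtain ⟨⟨x, y, t⟩, hp⟩ := p
     obtain ⟨k, rfl⟩ := htime _ _ _ ⟨hS hp.1, hp.2⟩
     simp only [restrict, hfloor]
     exact sliceAux_of_mem n I J S g k x y hp
  obtain ⟨f, hf, hfS⟩ := hex
  refine ⟨f, ⟨hf, hfS⟩, ?_⟩
  rintro f' ⟨hf', hfS'⟩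
  have main : ∀ k : ℕ, ∀ x y t : ℝ, ∀ h : (x, y, t) ∈ A ∩ lattice n, t = (k : ℝ) - n →
      f' ⟨_, h⟩ = f ⟨_, h⟩ := by
    intro k
    induction k using Nat.strong_induction_on with
    | _ k ih =>
    intro x y t' h hk
    by_cases hpS : (x, y, t') ∈ S
    · have h1 := congrFun hfS ⟨_, hpS, h.2⟩
      have h2 := congrFun hfS' ⟨_, hpS, h.2⟩
      exact h2.trans h1.symm
    obtain ⟨t, rfl⟩ : ∃ t, t' = t + 1 := ⟨t' - 1, by ring⟩
    obtain ⟨hdA, a1, a2, a3, a4⟩ := hstep x y t h hpS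
    have sh : ∀ a b : ℤ, ∀ c : ℤ, Even (a + b + (c - 1)) →
        (x + a, y + b, t + c) ∈ lattice n := by
      intro a b c he
      have := lattice_shift h.2 a b (c - 1) he
      convert this using 3
      push_cast; ring
    have hd : (x, y, t - 1) ∈ A ∩ lattice n := by
      refine ⟨hdA, ?_⟩
      have := sh 0 0 (-1) (by decide)
      simpa [sub_eq_add_neg] using this
    have l1 : (x + 1, y, t) ∈ lattice n := by simpa using sh 1 0 0 (by decide)
    have l2 : (x - 1, y, t) ∈ lattice n := by
      simpa [sub_eq_add_neg] using sh (-1) 0 0 (by decide)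
    have l3 : (x, y + 1, t) ∈ lattice n := by simpa using sh 0 1 0 (by decide)
    have l4 : (x, y - 1, t) ∈ lattice n := by
      simpa [sub_eq_add_neg] using sh 0 (-1) 0 (by decide)
    obtain ⟨j, hj⟩ := htime _ _ _ hd
    have hjk : k = j + 2 := by
      have : (k : ℝ) = ((j + 2 : ℕ) : ℝ) := by push_cast; linarith
      exact_mod_cast this
    have ed := ih j (by omega) _ _ _ hd hj
    have en : ∀ a b : ℝ, ∀ hn : (a, b, t) ∈ A ∩ lattice n, f' ⟨_, hn⟩ = f ⟨_, hn⟩ :=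
      fun a b hn => ih (j + 1) (by omega) a b t hn (by push_cast; linarith)
    obtain ⟨hxI, hyJ⟩ := hY _ _ _ h.1
    by_cases hx : x ∈ interior I <;> by_cases hy : y ∈ interior J
    · rw [hf.inner x y t hx hy h hd (Set.mem_inter (a1 hx).1 l1) (Set.mem_inter (a1 hx).2 l2) (Set.mem_inter (a3 hy).1 l3)
          (Set.mem_inter (a3 hy).2 l4),
        hf'.inner x y t hx hy h hd (Set.mem_inter (a1 hx).1 l1) (Set.mem_inter (a1 hx).2 l2) (Set.mem_inter (a3 hy).1 l3)
          (Set.mem_inter (a3 hy).2 l4), ed, en, en, en, en]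
    · rw [hf.wall_y x y t hx ⟨hyJ, hy⟩ h hd (Set.mem_inter (a1 hx).1 l1) (Set.mem_inter (a1 hx).2 l2),
        hf'.wall_y x y t hx ⟨hyJ, hy⟩ h hd (Set.mem_inter (a1 hx).1 l1) (Set.mem_inter (a1 hx).2 l2), ed, en, en]
    · rw [hf.wall_x x y t ⟨hxI, hx⟩ hy h hd (Set.mem_inter (a3 hy).1 l3) (Set.mem_inter (a3 hy).2 l4),
        hf'.wall_x x y t ⟨hxI, hx⟩ hy h hd (Set.mem_inter (a3 hy).1 l3) (Set.mem_inter (a3 hy).2 l4), ed, en, en]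
    · have b1 : ∃ σ : ℝ, (σ = 1 ∨ σ = -1) ∧ (x + σ, y, t) ∈ A ∩ lattice n := by
        rcases a2 hx with h' | h'
        · exact ⟨1, Or.inl rfl, h', l1⟩
        · exact ⟨-1, Or.inr rfl, by rw [← sub_eq_add_neg]; exact ⟨h', l2⟩⟩
      have b2 : ∃ τ : ℝ, (τ = 1 ∨ τ = -1) ∧ (x, y + τ, t) ∈ A ∩ lattice n := by
        rcases a4 hy with h' | h'
        · exact ⟨1, Or.inl rfl, h', l3⟩
        · exact ⟨-1, Or.inr rfl, by rw [← sub_eq_add_neg]; exact ⟨h', l4⟩⟩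
      obtain ⟨σ, hσ, hσA⟩ := b1
      obtain ⟨τ, hτ, hτA⟩ := b2
      rw [hf.corner x y t σ τ ⟨hxI, hx⟩ ⟨hyJ, hy⟩ hσ hτ (hY _ _ _ hσA.1).1
          (hY _ _ _ hτA.1).2 h hd hσA hτA,
        hf'.corner x y t σ τ ⟨hxI, hx⟩ ⟨hyJ, hy⟩ hσ hτ (hY _ _ _ hσA.1).1
          (hY _ _ _ hτA.1).2 h hd hσA hτA, ed, en, en]
  funext p
  obtain ⟨⟨x, y, t⟩, hp⟩ := p
  obtain ⟨k, hk⟩ := htime _ _ _ hp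
  exact main k x y t hp hk

/-! ### The half-octahedron and its boundaries -/

/-- The half-octahedron `A₁ = {|x| + |y| + |t| ≤ n}` in `Y₁ = ℝ × ℝ≥0 × ℝ`. -/
def A₁ (n : ℕ) : Set (ℝ × ℝ × ℝ) :=
  {p | p.1 ∈ Set.univ ∧ p.2.1 ∈ Set.Ici (0 : ℝ) ∧ |p.1| + |p.2.1| + |p.2.2| ≤ n}

/-- The lower boundary of `A₁`. -/
def S₁ (n : ℕ) : Set (ℝ × ℝ × ℝ) :=
  convexHull ℝ {((n : ℝ), (0 : ℝ), (0 : ℝ)), (0, (n : ℝ), 0), (0, 0, -(n : ℝ))} ∪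
    convexHull ℝ {(-(n : ℝ), (0 : ℝ), (0 : ℝ)), (0, (n : ℝ), 0), (0, 0, -(n : ℝ))}

/-- The upper boundary of `A₁`. -/
def S₁' (n : ℕ) : Set (ℝ × ℝ × ℝ) :=
  convexHull ℝ {((n : ℝ), (0 : ℝ), (0 : ℝ)), (0, (n : ℝ), 0), (0, 0, (n : ℝ))} ∪
    convexHull ℝ {(-(n : ℝ), (0 : ℝ), (0 : ℝ)), (0, (n : ℝ), 0), (0, 0, (n : ℝ))}

/-- The domain `A₂ = {x + y - n ≤ t ≤ y - x + n}` in `Y₂ = ℝ≥0 × [0, n] × ℝ`. -/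
def A₂ (n : ℕ) : Set (ℝ × ℝ × ℝ) :=
  {p | p.1 ∈ Set.Ici (0 : ℝ) ∧ p.2.1 ∈ Set.Icc (0 : ℝ) n ∧
    p.1 + p.2.1 - n ≤ p.2.2 ∧ p.2.2 ≤ p.2.1 - p.1 + n}

/-- The lower boundary of `A₂`. -/
def S₂ (n : ℕ) : Set (ℝ × ℝ × ℝ) :=
  convexHull ℝ {((0 : ℝ), (0 : ℝ), -(n : ℝ)), ((n : ℝ), 0, 0), (0, (n : ℝ), 0),
    ((n : ℝ), (n : ℝ), (n : ℝ))}

/-- The upper boundary of `A₂`. -/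
def S₂' (n : ℕ) : Set (ℝ × ℝ × ℝ) :=
  convexHull ℝ {((n : ℝ), (0 : ℝ), (0 : ℝ)), (0, 0, (n : ℝ)), ((n : ℝ), (n : ℝ), (n : ℝ)),
    (0, (n : ℝ), 2 * (n : ℝ))}

theorem mem_triangle (n : ℕ) {α β : ℝ} (hα : α = 1 ∨ α = -1) (hβ : β = 1 ∨ β = -1)
    (x y t : ℝ) :
    (x, y, t) ∈ convexHull ℝ {(α * (n : ℝ), (0 : ℝ), (0 : ℝ)), (0, (n : ℝ), 0),
      (0, 0, β * (n : ℝ))} ↔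
    0 ≤ α * x ∧ 0 ≤ y ∧ 0 ≤ β * t ∧ α * x + y + β * t = n := by
  have ha : α * α = 1 := by rcases hα with rfl | rfl <;> norm_num
  have hb : β * β = 1 := by rcases hβ with rfl | rfl <;> norm_num
  have hn : (0 : ℝ) ≤ n := Nat.cast_nonneg n
  constructor
  · intro h
    have hc : Convex ℝ {p : ℝ × ℝ × ℝ | 0 ≤ α * p.1 ∧ 0 ≤ p.2.1 ∧ 0 ≤ β * p.2.2 ∧
        α * p.1 + p.2.1 + β * p.2.2 = n} := by
      rintro ⟨a, b, c⟩ ⟨h1, h2, h3, h4⟩ ⟨a', b', c'⟩ ⟨h1', h2', h3', h4'⟩ u v hu hv huv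
      simp only [Set.mem_ofPred_eq, Prod.smul_mk, Prod.mk_add_mk, smul_eq_mul] at *
      refine ⟨?_, by positivity, ?_, ?_⟩
      · have := add_nonneg (mul_nonneg hu h1) (mul_nonneg hv h1'); linarith
      · have := add_nonneg (mul_nonneg hu h3) (mul_nonneg hv h3'); linarith
      · linear_combination u * h4 + v * h4' + (n : ℝ) * huv
    refine convexHull_min ?_ hc h
    rintro p (rfl | rfl | rfl) <;>
      simp only [Set.mem_ofPred_eq, ← mul_assoc, ha, hb] <;> norm_num
  · rintro ⟨h1, h2, h3, h4⟩
    rcases eq_or_lt_of_le hn with h0 | h0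
    · have e1 : α * x = 0 := by linarith
      have e2 : y = 0 := by linarith
      have e3 : β * t = 0 := by linarith
      have e1' : x = 0 := by linear_combination α * e1 - x * ha
      have e3' : t = 0 := by linear_combination β * e3 - t * hb
      rw [← h0, e1', e2, e3']
      apply subset_convexHull
      simp
    · have key := (convex_convexHull ℝ {(α * (n : ℝ), (0 : ℝ), (0 : ℝ)), (0, (n : ℝ), 0),
        (0, 0, β * (n : ℝ))}).sum_mem (t := (Finset.univ : Finset (Fin 3)))
        (w := ![α * x / n, y / n, β * t / n])
        (z := ![(α * (n : ℝ), (0 : ℝ), (0 : ℝ)), (0, (n : ℝ), 0), (0, 0, β * (n : ℝ))])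
        (by intro i _; fin_cases i <;> simp <;> positivity)
        (by
          simp only [Fin.sum_univ_three, Matrix.cons_val]
          rw [← add_div, ← add_div, h4, div_self h0.ne'])
        (by intro i _; apply subset_convexHull; fin_cases i <;> simp)
      simp only [Fin.sum_univ_three, Matrix.cons_val, Prod.smul_mk, Prod.mk_add_mk,
        smul_eq_mul, mul_zero, add_zero, zero_add] at key
      convert key using 2
      · field_simp
        linear_combination (-x) * ha
      · congr 1
        · field_simp
        · field_simp
          linear_combination (-t) * hb

theorem mem_S₁ (n : ℕ) (x y t : ℝ) :
    (x, y, t) ∈ S₁ n ↔ 0 ≤ y ∧ t ≤ 0 ∧ |x| + y - t = n := by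
  have h1 := mem_triangle n (Or.inl rfl) (Or.inr rfl) x y t
  have h2 := mem_triangle n (Or.inr rfl) (Or.inr rfl) x y t
  simp only [one_mul, neg_one_mul] at h1 h2
  rw [S₁, Set.mem_union, h1, h2]
  rcases abs_cases x with ⟨h, h'⟩ | ⟨h, h'⟩ <;> rw [h] <;> constructor
  · rintro (⟨a, b, c, d⟩ | ⟨a, b, c, d⟩) <;> exact ⟨b, by linarith, by linarith⟩
  · rintro ⟨a, b, c⟩; exact Or.inl ⟨h', a, by linarith, by linarith⟩
  · rintro (⟨a, b, c, d⟩ | ⟨a, b, c, d⟩) <;> exact ⟨b, by linarith, by linarith⟩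
  · rintro ⟨a, b, c⟩; exact Or.inr ⟨by linarith, a, by linarith, by linarith⟩

theorem mem_S₁' (n : ℕ) (x y t : ℝ) :
    (x, y, t) ∈ S₁' n ↔ 0 ≤ y ∧ 0 ≤ t ∧ |x| + y + t = n := by
  have h1 := mem_triangle n (Or.inl rfl) (Or.inl rfl) x y t
  have h2 := mem_triangle n (Or.inr rfl) (Or.inl rfl) x y t
  simp only [one_mul, neg_one_mul] at h1 h2
  rw [S₁', Set.mem_union, h1, h2]
  rcases abs_cases x with ⟨h, h'⟩ | ⟨h, h'⟩ <;> rw [h] <;> constructor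
  · rintro (⟨a, b, c, d⟩ | ⟨a, b, c, d⟩) <;> exact ⟨b, by linarith, by linarith⟩
  · rintro ⟨a, b, c⟩; exact Or.inl ⟨h', a, by linarith, by linarith⟩
  · rintro (⟨a, b, c, d⟩ | ⟨a, b, c, d⟩) <;> exact ⟨b, by linarith, by linarith⟩
  · rintro ⟨a, b, c⟩; exact Or.inr ⟨by linarith, a, by linarith, by linarith⟩

theorem mem_square (n : ℕ) (a b c : ℝ) (s : Set (ℝ × ℝ × ℝ))
    (hs : s = {((0 : ℝ), (0 : ℝ), c * n), ((n : ℝ), (0 : ℝ), (a + c) * n),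
      ((0 : ℝ), (n : ℝ), (b + c) * n), ((n : ℝ), (n : ℝ), (a + b + c) * n)}) (x y t : ℝ) :
    (x, y, t) ∈ convexHull ℝ s ↔
    0 ≤ x ∧ x ≤ n ∧ 0 ≤ y ∧ y ≤ n ∧ t = a * x + b * y + c * n := by
  have hn : (0 : ℝ) ≤ n := Nat.cast_nonneg n
  subst hs
  constructor
  · intro h
    have hc : Convex ℝ {p : ℝ × ℝ × ℝ | 0 ≤ p.1 ∧ p.1 ≤ n ∧ 0 ≤ p.2.1 ∧ p.2.1 ≤ n ∧
        p.2.2 = a * p.1 + b * p.2.1 + c * n} := by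
      rintro ⟨x1, y1, t1⟩ ⟨h1, h2, h3, h4, h5⟩ ⟨x2, y2, t2⟩ ⟨h1', h2', h3', h4', h5'⟩ u v hu hv
        huv
      simp only [Set.mem_ofPred_eq, Prod.smul_mk, Prod.mk_add_mk, smul_eq_mul] at *
      have e : (n : ℝ) = u * n + v * n := by rw [← add_mul, huv, one_mul]
      refine ⟨by positivity, ?_, by positivity, ?_, ?_⟩
      · rw [e]; gcongr
      · rw [e]; gcongr
      · linear_combination u * h5 + v * h5' + c * n * huv
    refine convexHull_min ?_ hc h
    rintro p (rfl | rfl | rfl | rfl) <;> simp only [Set.mem_ofPred_eq] <;>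
      refine ⟨by linarith, by linarith, by linarith, by linarith, by ring⟩
  · rintro ⟨h1, h2, h3, h4, h5⟩
    rcases eq_or_lt_of_le hn with h0 | h0
    · have e1 : x = 0 := by linarith
      have e2 : y = 0 := by linarith
      apply subset_convexHull
      left
      rw [h5, e1, e2]
      simp
    · have key := (convex_convexHull ℝ {((0 : ℝ), (0 : ℝ), c * (n : ℝ)),
          ((n : ℝ), (0 : ℝ), (a + c) * (n : ℝ)), ((0 : ℝ), (n : ℝ), (b + c) * (n : ℝ)),
          ((n : ℝ), (n : ℝ), (a + b + c) * (n : ℝ))}).sum_mem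
        (t := (Finset.univ : Finset (Fin 4)))
        (w := ![(1 - x / n) * (1 - y / n), (x / n) * (1 - y / n), (1 - x / n) * (y / n),
          (x / n) * (y / n)])
        (z := ![((0 : ℝ), (0 : ℝ), c * n), ((n : ℝ), (0 : ℝ), (a + c) * n),
          ((0 : ℝ), (n : ℝ), (b + c) * n), ((n : ℝ), (n : ℝ), (a + b + c) * n)])
        (by
          have i1 : 0 ≤ x / n := by positivity
          have i2 : 0 ≤ y / n := by positivity
          have i3 : 0 ≤ 1 - x / n := by rw [sub_nonneg, div_le_one h0]; exact h2
          have i4 : 0 ≤ 1 - y / n := by rw [sub_nonneg, div_le_one h0]; exact h4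
          intro i _
          fin_cases i
          · exact mul_nonneg i3 i4
          · exact mul_nonneg i1 i4
          · exact mul_nonneg i3 i2
          · exact mul_nonneg i1 i2)
        (by
          simp only [Fin.sum_univ_four, Matrix.cons_val]
          ring)
        (by intro i _; apply subset_convexHull; fin_cases i <;> simp)
      simp only [Fin.sum_univ_four, Matrix.cons_val, Prod.smul_mk, Prod.mk_add_mk,
        smul_eq_mul, mul_zero, add_zero, zero_add] at key
      convert key using 2
      · field_simp; ring
      · congr 1
        · field_simp; ring
        · rw [h5]; field_simp; ring

theorem mem_S₂ (n : ℕ) (x y t : ℝ) :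
    (x, y, t) ∈ S₂ n ↔ 0 ≤ x ∧ x ≤ n ∧ 0 ≤ y ∧ y ≤ n ∧ t = x + y - n := by
  rw [S₂, mem_square n 1 1 (-1)]
  · simp only [one_mul, neg_one_mul, sub_eq_add_neg]
  · norm_num

theorem mem_S₂' (n : ℕ) (x y t : ℝ) :
    (x, y, t) ∈ S₂' n ↔ 0 ≤ x ∧ x ≤ n ∧ 0 ≤ y ∧ y ≤ n ∧ t = y - x + n := by
  rw [S₂', mem_square n (-1) 1 1]
  · rw [show -1 * x + 1 * y + 1 * (n : ℝ) = y - x + n by ring]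
  · ext p
    norm_num
    tauto

theorem S₁_subset (n : ℕ) : S₁ n ⊆ A₁ n := by
  rintro ⟨x, y, t⟩ h
  rw [mem_S₁] at h
  refine ⟨trivial, h.1, ?_⟩
  simp only [abs_of_nonneg h.1, abs_of_nonpos h.2.1]
  linarith

theorem S₁'_subset (n : ℕ) : S₁' n ⊆ A₁ n := by
  rintro ⟨x, y, t⟩ h
  rw [mem_S₁'] at h
  refine ⟨trivial, h.1, ?_⟩
  simp only [abs_of_nonneg h.1, abs_of_nonneg h.2.1]
  linarith

theorem S₂_subset (n : ℕ) : S₂ n ⊆ A₂ n := by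
  rintro ⟨x, y, t⟩ h
  rw [mem_S₂] at h
  obtain ⟨h1, h2, h3, h4, h5⟩ := h
  exact ⟨h1, ⟨h3, h4⟩, by dsimp only; linarith, by dsimp only; linarith⟩

theorem S₂'_subset (n : ℕ) : S₂' n ⊆ A₂ n := by
  rintro ⟨x, y, t⟩ h
  rw [mem_S₂'] at h
  obtain ⟨h1, h2, h3, h4, h5⟩ := h
  exact ⟨h1, ⟨h3, h4⟩, by dsimp only; linarith, by dsimp only; linarith⟩

theorem mem_A₁ (n : ℕ) (x y t : ℝ) : (x, y, t) ∈ A₁ n ↔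
    0 ≤ y ∧ x + y + t ≤ n ∧ x + y - t ≤ n ∧ -x + y + t ≤ n ∧ -x + y - t ≤ n := by
  change (x ∈ Set.univ ∧ 0 ≤ y ∧ |x| + |y| + |t| ≤ n) ↔ _
  constructor
  · rintro ⟨-, h1, h2⟩
    rw [abs_of_nonneg h1] at h2
    have := le_abs_self x
    have := neg_le_abs x
    have := le_abs_self t
    have := neg_le_abs t
    refine ⟨h1, by linarith, by linarith, by linarith, by linarith⟩
  · rintro ⟨h1, h2, h3, h4, h5⟩
    refine ⟨trivial, h1, ?_⟩
    rw [abs_of_nonneg h1]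
    rcases abs_cases x with ⟨h, -⟩ | ⟨h, -⟩ <;> rcases abs_cases t with ⟨h', -⟩ | ⟨h', -⟩ <;>
      rw [h, h'] <;> linarith

theorem mem_A₂ (n : ℕ) (x y t : ℝ) : (x, y, t) ∈ A₂ n ↔
    0 ≤ x ∧ 0 ≤ y ∧ y ≤ n ∧ x + y - n ≤ t ∧ t ≤ y - x + n := by
  change (0 ≤ x ∧ (0 ≤ y ∧ y ≤ n) ∧ x + y - n ≤ t ∧ t ≤ y - x + n) ↔ _
  tauto

theorem wellPosed₁ (n : ℕ) (F : Type*) [PosSemifield F] :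
    WellPosed (n : ℤ) Set.univ (Set.Ici 0) (S₁_subset n) F := by
  apply wellPosed_of (S₁_subset n) Set.ordConnected_univ Set.ordConnected_Ici
  · intro x y t h
    exact ⟨h.1, h.2.1⟩
  · intro x y t h
    rw [mem_A₁] at h
    push_cast
    linarith
  · intro x y t h h'
    rw [mem_A₁] at h
    rw [mem_S₁] at h'
    rcases abs_cases x with ⟨e, -⟩ | ⟨e, -⟩ <;> rw [e] at h' <;> linarith
  · rintro x y t ⟨h, i, j, k, hp, hev⟩ hS
    simp only [Prod.mk.injEq] at hp
    obtain ⟨rfl, rfl, hk⟩ := hp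
    rw [hk] at h hS
    obtain rfl : t = (k : ℝ) - 1 := by linarith
    rw [Int.even_iff] at hev
    have cast : ∀ a b c : ℤ, ((a : ℝ), (b : ℝ), (c : ℝ)) ∈ A₁ n ↔
        0 ≤ b ∧ a + b + c ≤ n ∧ a + b - c ≤ n ∧ -a + b + c ≤ n ∧ -a + b - c ≤ n := by
      intro a b c
      rw [mem_A₁]
      norm_cast
    have h' := (cast i j k).1 h
    have hS' : ¬ (0 ≤ j ∧ k ≤ 0 ∧ |i| + j - k = n) := by
      intro h0; apply hS; rw [mem_S₁]; exact_mod_cast h0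
    have hS1 : i + j - k ≠ n ∧ -i + j - k ≠ n := by
      rcases abs_cases i with ⟨e, e'⟩ | ⟨e, e'⟩ <;> rw [e] at hS' <;> omega
    have g0 := (cast i j (k - 2)).2
    have g1 := (cast (i + 1) j (k - 1)).2
    have g2 := (cast (i - 1) j (k - 1)).2
    have g3 := (cast i (j + 1) (k - 1)).2
    have g4 := (cast i (j - 1) (k - 1)).2
    push_cast at g0 g1 g2 g3 g4
    rw [sub_sub, one_add_one_eq_two, interior_univ, interior_Ici]
    have e2 : (j : ℝ) ∈ Set.Ioi (0 : ℝ) ↔ 0 < j := by simp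
    rw [e2]
    clear hS hS' cast hk h e2
    refine ⟨g0 (by omega), fun _ => ⟨g1 (by omega), g2 (by omega)⟩,
      fun h => absurd trivial h, fun hj => ⟨g3 (by omega), g4 (by omega)⟩,
      fun hj => Or.inl (g3 (by omega))⟩

theorem wellPosed₂ (n : ℕ) (F : Type*) [PosSemifield F] :
    WellPosed (n : ℤ) (Set.Ici 0) (Set.Icc 0 (n : ℝ)) (S₂_subset n) F := by
  apply wellPosed_of (S₂_subset n) Set.ordConnected_Ici Set.ordConnected_Icc
  · intro x y t h
    exact ⟨h.1, h.2.1⟩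
  · intro x y t h
    rw [mem_A₂] at h
    push_cast
    linarith
  · intro x y t h h'
    rw [mem_A₂] at h
    rw [mem_S₂] at h'
    linarith
  · rintro x y t ⟨h, i, j, k, hp, hev⟩ hS
    simp only [Prod.mk.injEq] at hp
    obtain ⟨rfl, rfl, hk⟩ := hp
    rw [hk] at h hS
    obtain rfl : t = (k : ℝ) - 1 := by linarith
    rw [Int.even_iff] at hev
    have cast : ∀ a b c : ℤ, ((a : ℝ), (b : ℝ), (c : ℝ)) ∈ A₂ n ↔
        0 ≤ a ∧ 0 ≤ b ∧ b ≤ n ∧ a + b - n ≤ c ∧ c ≤ b - a + n := by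
      intro a b c
      rw [mem_A₂]
      norm_cast
    have h' := (cast i j k).1 h
    have hS' : ¬ (0 ≤ i ∧ i ≤ n ∧ 0 ≤ j ∧ j ≤ n ∧ k = i + j - n) := by
      intro h0; apply hS; rw [mem_S₂]; exact_mod_cast h0
    have hS1 : i + j - n + 2 ≤ k := by omega
    have g0 := (cast i j (k - 2)).2
    have g1 := (cast (i + 1) j (k - 1)).2
    have g2 := (cast (i - 1) j (k - 1)).2
    have g3 := (cast i (j + 1) (k - 1)).2
    have g4 := (cast i (j - 1) (k - 1)).2
    push_cast at g0 g1 g2 g3 g4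
    rw [sub_sub, one_add_one_eq_two, interior_Ici, interior_Icc]
    have e1 : (i : ℝ) ∈ Set.Ioi (0 : ℝ) ↔ 0 < i := by simp
    have e2 : (j : ℝ) ∈ Set.Ioo (0 : ℝ) n ↔ 0 < j ∧ j < n := by
      rw [Set.mem_Ioo]; norm_cast
    rw [e1, e2]
    clear hS hS' hev cast hk h e1 e2
    refine ⟨g0 (by omega), fun hi => ⟨g1 (by omega), g2 (by omega)⟩,
      fun hi => Or.inl (g1 (by omega)), fun hj => ⟨g3 (by omega), g4 (by omega)⟩, fun hj => ?_⟩
    by_cases h : j = 0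
    · exact Or.inl (g3 (by omega))
    · exact Or.inr (g4 (by omega))

/-- The map `φ̄₁ : P𝓗(S₁) → P𝓗(S₁')` induced by the recurrence in `A₁`. -/
noncomputable def projPhi₁ (n : ℕ) (F : Type*) [PosSemifield F] :
    ProjState n (S₁ n) F → ProjState n (S₁' n) F :=
  projEvolution (S₁'_subset n) (wellPosed₁ n F)

/-- The map `φ̄₂ : P𝓗(S₂) → P𝓗(S₂')` induced by the recurrence in `A₂`. -/
noncomputable def projPhi₂ (n : ℕ) (F : Type*) [PosSemifield F] :
    ProjState n (S₂ n) F → ProjState n (S₂' n) F :=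
  projEvolution (S₂'_subset n) (wellPosed₂ n F)

/-! ### The identifications of the boundaries -/

open Classical in
/-- The map `s : S₁ → S₂`. It is linear on each of the two triangles `0 ≤ x` and `x ≤ 0` of `S₁`;
the values at the vertices are given in `s_vertices` below. -/
noncomputable def sFun (p : ℝ × ℝ × ℝ) : ℝ × ℝ × ℝ :=
  if 0 ≤ p.1 then (p.1 - p.2.2, p.1 + p.2.1, p.1) else (-p.2.2, p.2.1, p.1)

open Classical in
/-- The map `s' : S₁' → S₂'`. It is linear on each of the two triangles `0 ≤ x` and `x ≤ 0` of
`S₁'`; the values at the vertices are given in `s'_vertices` below. -/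
noncomputable def sFun' (p : ℝ × ℝ × ℝ) : ℝ × ℝ × ℝ :=
  if 0 ≤ p.1 then (p.2.2, p.1 + p.2.2, 2 * p.1 + p.2.1 + p.2.2)
  else (p.2.2 - p.1, p.2.2, p.2.1 + p.2.2)

theorem sFun_of_nonneg {x : ℝ} (hx : 0 ≤ x) (y t : ℝ) : sFun (x, y, t) = (x - t, x + y, x) :=
  if_pos hx

theorem sFun_of_nonpos {x : ℝ} (hx : x ≤ 0) (y t : ℝ) : sFun (x, y, t) = (-t, y, x) := by
  rcases eq_or_lt_of_le hx with rfl | h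
  · rw [sFun_of_nonneg le_rfl, zero_sub, zero_add]
  · exact if_neg (not_le.2 h)

theorem sFun'_of_nonneg {x : ℝ} (hx : 0 ≤ x) (y t : ℝ) :
    sFun' (x, y, t) = (t, x + t, 2 * x + y + t) :=
  if_pos hx

theorem sFun'_of_nonpos {x : ℝ} (hx : x ≤ 0) (y t : ℝ) :
    sFun' (x, y, t) = (t - x, t, y + t) := by
  rcases eq_or_lt_of_le hx with rfl | h
  · rw [sFun'_of_nonneg le_rfl, sub_zero, zero_add, mul_zero, zero_add]
  · exact if_neg (not_le.2 h)

theorem s_vertices (n : ℕ) :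
    sFun ((n : ℝ), 0, 0) = ((n : ℝ), (n : ℝ), (n : ℝ)) ∧
    sFun (0, (n : ℝ), 0) = (0, (n : ℝ), 0) ∧
    sFun (0, 0, -(n : ℝ)) = ((n : ℝ), 0, 0) ∧
    sFun (-(n : ℝ), 0, 0) = (0, 0, -(n : ℝ)) := by
  have hn : (0 : ℝ) ≤ n := Nat.cast_nonneg n
  rw [sFun_of_nonneg hn, sFun_of_nonneg le_rfl, sFun_of_nonneg le_rfl,
    sFun_of_nonpos (neg_nonpos.2 hn)]
  simp

theorem s'_vertices (n : ℕ) :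
    sFun' ((n : ℝ), 0, 0) = (0, (n : ℝ), 2 * (n : ℝ)) ∧
    sFun' (0, (n : ℝ), 0) = (0, 0, (n : ℝ)) ∧
    sFun' (0, 0, (n : ℝ)) = ((n : ℝ), (n : ℝ), (n : ℝ)) ∧
    sFun' (-(n : ℝ), 0, 0) = ((n : ℝ), 0, 0) := by
  have hn : (0 : ℝ) ≤ n := Nat.cast_nonneg n
  rw [sFun'_of_nonneg hn, sFun'_of_nonneg le_rfl, sFun'_of_nonneg le_rfl,
    sFun'_of_nonpos (neg_nonpos.2 hn)]
  simp

/-- The identification `s : S₁ → S₂` of the lower boundaries. -/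
noncomputable def s (n : ℕ) : S₁ n ≃ S₂ n where
  toFun p := ⟨sFun p, by
    obtain ⟨⟨x, y, t⟩, h⟩ := p
    rw [mem_S₁] at h
    rcases le_total 0 x with hx | hx
    · rw [sFun_of_nonneg hx, mem_S₂]
      rw [abs_of_nonneg hx] at h
      refine ⟨?_, ?_, ?_, ?_, ?_⟩ <;> linarith
    · rw [sFun_of_nonpos hx, mem_S₂]
      rw [abs_of_nonpos hx] at h
      refine ⟨?_, ?_, ?_, ?_, ?_⟩ <;> linarith⟩
  invFun p := ⟨(p.1.2.2, p.1.2.1 - max p.1.2.2 0, max p.1.2.2 0 - p.1.1), by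
    obtain ⟨⟨x, y, t⟩, h⟩ := p
    rw [mem_S₂] at h
    rw [mem_S₁]
    dsimp only
    rcases le_total 0 t with ht | ht
    · rw [abs_of_nonneg ht, max_eq_left ht]
      refine ⟨?_, ?_, ?_⟩ <;> linarith
    · rw [abs_of_nonpos ht, max_eq_right ht]
      refine ⟨?_, ?_, ?_⟩ <;> linarith⟩
  left_inv := by
    rintro ⟨⟨x, y, t⟩, h⟩
    apply Subtype.ext
    dsimp only
    rcases le_total 0 x with hx | hx
    · rw [sFun_of_nonneg hx]; simp [hx]
    · rw [sFun_of_nonpos hx]; simp [hx]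
  right_inv := by
    rintro ⟨⟨x, y, t⟩, h⟩
    apply Subtype.ext
    dsimp only
    rcases le_total 0 t with hx | hx
    · rw [sFun_of_nonneg hx]; simp [hx]
    · rw [sFun_of_nonpos hx]; simp [hx]

/-- The identification `s' : S₁' → S₂'` of the upper boundaries. -/
noncomputable def s' (n : ℕ) : S₁' n ≃ S₂' n where
  toFun p := ⟨sFun' p, by
    obtain ⟨⟨x, y, t⟩, h⟩ := p
    rw [mem_S₁'] at h
    rcases le_total 0 x with hx | hx
    · rw [sFun'_of_nonneg hx, mem_S₂']
      rw [abs_of_nonneg hx] at h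
      refine ⟨?_, ?_, ?_, ?_, ?_⟩ <;> linarith
    · rw [sFun'_of_nonpos hx, mem_S₂']
      rw [abs_of_nonpos hx] at h
      refine ⟨?_, ?_, ?_, ?_, ?_⟩ <;> linarith⟩
  invFun p := ⟨(p.1.2.1 - p.1.1, n - |p.1.2.1 - p.1.1| - min p.1.1 p.1.2.1,
      min p.1.1 p.1.2.1), by
    obtain ⟨⟨x, y, t⟩, h⟩ := p
    rw [mem_S₂'] at h
    rw [mem_S₁']
    dsimp only
    rcases le_total x y with hx | hx
    · rw [abs_of_nonneg (sub_nonneg.2 hx), min_eq_left hx]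
      refine ⟨?_, ?_, ?_⟩ <;> linarith
    · rw [abs_of_nonpos (sub_nonpos.2 hx), min_eq_right hx]
      refine ⟨?_, ?_, ?_⟩ <;> linarith⟩
  left_inv := by
    rintro ⟨⟨x, y, t⟩, h⟩
    apply Subtype.ext
    rw [mem_S₁'] at h
    dsimp only
    rcases le_total 0 x with hx | hx
    · rw [sFun'_of_nonneg hx]
      rw [abs_of_nonneg hx] at h
      dsimp only
      rw [min_eq_left (by linarith), add_sub_cancel_right, abs_of_nonneg hx,
        ← h.2.2]
      ring_nf
    · rw [sFun'_of_nonpos hx]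
      rw [abs_of_nonpos hx] at h
      dsimp only
      rw [min_eq_right (by linarith), show t - (t - x) = x by ring, abs_of_nonpos hx,
        ← h.2.2]
      ring_nf
  right_inv := by
    rintro ⟨⟨x, y, t⟩, h⟩
    apply Subtype.ext
    rw [mem_S₂'] at h
    dsimp only
    rcases le_total x y with hx | hx
    · rw [sFun'_of_nonneg (sub_nonneg.2 hx), min_eq_left hx, abs_of_nonneg (sub_nonneg.2 hx),
        h.2.2.2.2]
      ring_nf
    · rw [sFun'_of_nonpos (sub_nonpos.2 hx), min_eq_right hx, abs_of_nonpos (sub_nonpos.2 hx),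
        h.2.2.2.2]
      ring_nf

theorem s_lattice (n : ℕ) (p : S₁ n) (h : (p : ℝ × ℝ × ℝ) ∈ lattice n) :
    (s n p : ℝ × ℝ × ℝ) ∈ lattice n := by
  obtain ⟨p, hp⟩ := p
  obtain ⟨x, y, t, rfl, hev⟩ := h
  change sFun _ ∈ _
  rw [Int.even_iff] at hev
  rcases le_total (0 : ℝ) x with hx | hx
  · rw [sFun_of_nonneg hx]
    exact ⟨x - t, x + y, x, by push_cast; rfl, by rw [Int.even_iff]; omega⟩
  · rw [sFun_of_nonpos hx]
    exact ⟨-t, y, x, by push_cast; rfl, by rw [Int.even_iff]; omega⟩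

theorem s'_lattice (n : ℕ) (p : S₁' n) (h : (p : ℝ × ℝ × ℝ) ∈ lattice n) :
    (s' n p : ℝ × ℝ × ℝ) ∈ lattice n := by
  obtain ⟨p, hp⟩ := p
  obtain ⟨x, y, t, rfl, hev⟩ := h
  change sFun' _ ∈ _
  rw [Int.even_iff] at hev
  rcases le_total (0 : ℝ) x with hx | hx
  · rw [sFun'_of_nonneg hx]
    exact ⟨t, x + t, 2 * x + y + t, by push_cast; rfl, by rw [Int.even_iff]; omega⟩
  · rw [sFun'_of_nonpos hx]
    exact ⟨t - x, t, y + t, by push_cast; rfl, by rw [Int.even_iff]; omega⟩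

/-- The pullback `s* : P𝓗(S₂) → P𝓗(S₁)`. -/
noncomputable def sPull (n : ℕ) (F : Type*) [PosSemifield F] :
    ProjState n (S₂ n) F → ProjState n (S₁ n) F :=
  projPullback (s n) (s_lattice n)

/-- The pullback `s'* : P𝓗(S₂') → P𝓗(S₁')`. -/
noncomputable def sPull' (n : ℕ) (F : Type*) [PosSemifield F] :
    ProjState n (S₂' n) F → ProjState n (S₁' n) F :=
  projPullback (s' n) (s'_lattice n)

end OctRec

/-! Both recurrences are solved by minors of one matrix `M`. Rescaling a solution on `A₁` by a
gauge, one may assume that it is `1` on the wall `y = 0`; by Dodgson condensation it then consists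
of the contiguous minors of an `n × n` matrix `M`, which are the maximal minors of `(1 | M)`, up to
sign, on suitable pairs of column intervals. For any sequence `v` of vectors in an `n`-dimensional
space, the determinants `det (v_{a-z}, …, v_{a-1}, v_{a+x}, …, v_{a+x+y-1})` with `y + z = n` solve
the recurrence on `A₂`, by the Plücker relations. Continuing the columns of `(1 | M)`
quasi-periodically, with period `2 n` and the right sign, makes the two families of minors agree on
the lower boundary and, up to one factor, on the upper boundary.

A general semifield is reduced to a field by running the recurrence on a generic state, whose values
are subtraction-free rational functions, and then evaluating. -/

namespace OctRec

/-! ### Determinants of lists of vectors -/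

section Determinants

theorem sum_det_updateRow_smul_row {R ι : Type*} [CommRing R] [Fintype ι] [DecidableEq ι]
    (m : Matrix ι ι R) (s : ι → R) :
    ∑ i, (m.updateRow i s).det • m i = m.det • s := by
  rw [← Matrix.det_transpose m, ← Matrix.mulVec_cramer]
  ext j
  simp [Matrix.mulVec, dotProduct, Matrix.cramer_transpose_apply, mul_comm]

theorem det_mul_det_updateRow_updateRow {R ι : Type*} [CommRing R] [Fintype ι] [DecidableEq ι]
    (m : Matrix ι ι R) {i j : ι} (hij : i ≠ j) (r s : ι → R) :
    m.det * ((m.updateRow i s).updateRow j r).det =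
      (m.updateRow i s).det * (m.updateRow j r).det +
        (m.updateRow j s).det * ((m.updateRow i (m j)).updateRow j r).det := by
  have expand : ∀ w, ((m.updateRow i w).updateRow j r).det =
      ((Matrix.detRowAlternating (R := R)).toMultilinearMap.toLinearMap (m.updateRow j r) i) w := by
    intro w
    rw [Matrix.updateRow_comm _ hij]
    rfl
  rw [expand s, ← smul_eq_mul, ← map_smul, ← sum_det_updateRow_smul_row, map_sum,
    Finset.sum_eq_add i j hij]
  · rw [map_smul, map_smul, ← expand, ← expand, Matrix.updateRow_eq_self]
    rfl
  · intro k _ hk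
    have equal_rows : ((m.updateRow i (m k)).updateRow j r).det = 0 :=
      Matrix.det_zero_of_row_eq hk.1.symm (by ext; simp [Matrix.updateRow_apply, hk, hij])
    rw [map_smul, ← expand, equal_rows, smul_zero]
  · simp
  · simp

variable {R : Type*} [CommRing R] {n : ℕ}

/-- The linear functional on the exterior algebra of `Rⁿ` that is the determinant in degree `n`
and vanishes in the other degrees. -/
noncomputable def topForm (R : Type*) [CommRing R] (n : ℕ) :
    ExteriorAlgebra R (Fin n → R) →ₗ[R] R :=
  ExteriorAlgebra.liftAlternating (Pi.single n Matrix.detRowAlternating)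

/-- The determinant of a list of `n` vectors of `Rⁿ`, and zero for a list of any other length. It
is defined through the exterior algebra so that vectors can be moved within concatenations of lists
without reindexing. -/
noncomputable def listDet (l : List (Fin n → R)) : R :=
  topForm R n (l.map (ExteriorAlgebra.ι R)).prod

theorem listDet_ofFn (m : Fin n → Fin n → R) :
    listDet (List.ofFn m) = (Matrix.of m).det := by
  have h := ExteriorAlgebra.liftAlternating_apply_ιMulti (R := R)
    (Pi.single n Matrix.detRowAlternating) m
  rw [ExteriorAlgebra.ιMulti_apply, Pi.single_eq_same] at h
  rw [listDet, List.map_ofFn]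
  exact h

theorem prod_map_ι_mul_ι {M : Type*} [AddCommGroup M] [Module R M] (l : List M) (v : M) :
    (l.map (ExteriorAlgebra.ι R)).prod * ExteriorAlgebra.ι R v =
      (-1 : R) ^ l.length • (ExteriorAlgebra.ι R v * (l.map (ExteriorAlgebra.ι R)).prod) := by
  induction l with
  | nil => simp
  | cons w l ih =>
    have swap : ExteriorAlgebra.ι R w * ExteriorAlgebra.ι R v =
        -(ExteriorAlgebra.ι R v * ExteriorAlgebra.ι R w) :=
      eq_neg_of_add_eq_zero_left (ExteriorAlgebra.ι_add_mul_swap w v)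
    rw [List.map_cons, List.prod_cons, mul_assoc, ih, mul_smul_comm, ← mul_assoc, swap, neg_mul,
      smul_neg, mul_assoc, List.length_cons, pow_succ, mul_neg_one, neg_smul]

theorem listDet_append_append_cons (l₁ l₂ l₃ : List (Fin n → R)) (v : Fin n → R) :
    listDet (l₁ ++ (l₂ ++ v :: l₃)) = (-1) ^ l₂.length * listDet (l₁ ++ v :: (l₂ ++ l₃)) := by
  simp only [listDet, List.map_append, List.map_cons, List.prod_append, List.prod_cons]
  rw [← mul_assoc _ (ExteriorAlgebra.ι R v) (List.map _ l₃).prod, prod_map_ι_mul_ι]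
  simp only [smul_mul_assoc, mul_smul_comm, map_smul, smul_eq_mul, mul_assoc]

theorem listDet_append_cons (l₁ l₂ : List (Fin n → R)) (v : Fin n → R) :
    listDet (l₁ ++ v :: l₂) = (-1) ^ l₁.length * listDet (v :: (l₁ ++ l₂)) :=
  listDet_append_append_cons [] l₁ l₂ v

theorem listDet_append_cons_append_cons (l₁ l₂ l₃ : List (Fin n → R)) (a b : Fin n → R) :
    listDet (l₁ ++ a :: (l₂ ++ b :: l₃)) =
      (-1) ^ l₂.length * listDet (a :: b :: (l₁ ++ (l₂ ++ l₃))) := by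
  have move_b := listDet_append_append_cons [a] (l₁ ++ l₂) l₃ b
  have square : ((-1 : R) ^ l₁.length) * (-1) ^ l₁.length = 1 := by rw [← mul_pow]; simp
  simp only [List.cons_append, List.nil_append, List.append_assoc, List.length_append,
    pow_add] at move_b
  rw [listDet_append_cons, move_b]
  linear_combination (-1) ^ l₂.length * listDet (a :: b :: (l₁ ++ (l₂ ++ l₃))) * square

theorem listDet_smul_cons (l : List (Fin n → R)) (c : R) (v : Fin n → R) :
    listDet (c • v :: l) = c * listDet (v :: l) := by
  simp only [listDet, List.map_cons, List.prod_cons, map_smul, smul_mul_assoc, smul_eq_mul]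

theorem listDet_plucker (l : List (Fin n → R)) (hl : l.length + 2 = n) (p q r s : Fin n → R) :
    listDet (p :: q :: l) * listDet (s :: r :: l) =
      listDet (s :: q :: l) * listDet (p :: r :: l) +
        listDet (p :: s :: l) * listDet (q :: r :: l) := by
  obtain ⟨k, rfl⟩ : ∃ k, n = k + 2 := ⟨_, hl.symm⟩
  obtain ⟨c, rfl⟩ : ∃ c : Fin k → Fin (k + 2) → R, l = List.ofFn c :=
    ⟨fun i => l.get (i.cast (by omega)), by
      rw [List.ofFn_congr (show k = l.length by omega)]
      exact (List.ofFn_get l).symm⟩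
  let rows (a b : Fin (k + 2) → R) : Matrix (Fin (k + 2)) (Fin (k + 2)) R :=
    Matrix.of (Fin.cons a (Fin.cons b c : Fin (k + 1) → _) : Fin (k + 2) → _)
  have det_rows (a b) : listDet (a :: b :: List.ofFn c) = (rows a b).det := by
    rw [← listDet_ofFn, List.ofFn_cons, List.ofFn_cons]
  have update_zero (a b w) : (rows a b).updateRow 0 w = rows w b :=
    Fin.update_cons_zero (α := fun _ => Fin (k + 2) → R) a _ w
  have update_one (a b w) : (rows a b).updateRow 1 w = rows a w := by
    have h := Fin.cons_update (α := fun _ => Fin (k + 2) → R) a (Fin.cons b c) 0 w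
    rw [Fin.update_cons_zero] at h
    exact h.symm
  have row_one : rows p q 1 = q := rfl
  have plucker := det_mul_det_updateRow_updateRow (rows p q) (zero_ne_one (α := Fin (k + 2))) r s
  simp only [row_one, update_zero, update_one] at plucker
  simpa only [det_rows] using plucker

end Determinants

section Segments

/-- The list of `l` consecutive terms of a sequence, starting with the term of index `s`. -/
def seg {M : Type*} (v : ℤ → M) (s : ℤ) (l : ℕ) : List M :=
  (List.range l).map fun i : ℕ => v (s + i)

variable {M : Type*} (v : ℤ → M)

@[simp] theorem seg_zero (s : ℤ) : seg v s 0 = [] := rfl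

@[simp] theorem length_seg (s : ℤ) (l : ℕ) : (seg v s l).length = l := by
  simp [seg]

theorem seg_add (s : ℤ) (k l : ℕ) : seg v s (k + l) = seg v s k ++ seg v (s + k) l := by
  simp [seg, List.range_add, add_assoc]

theorem seg_succ (s : ℤ) (l : ℕ) : seg v s (l + 1) = v s :: seg v (s + 1) l := by
  rw [add_comm, seg_add]
  simp [seg]

theorem seg_succ' (s : ℤ) (l : ℕ) : seg v s (l + 1) = seg v s l ++ [v (s + l)] := by
  rw [seg_add]
  simp [seg]

theorem seg_append {s t : ℤ} {k : ℕ} (h : t = s + k) (l : ℕ) :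
    seg v s k ++ seg v t l = seg v s (k + l) := by
  rw [h, seg_add]

theorem seg_eq_ofFn (s : ℤ) (l : ℕ) : seg v s l = List.ofFn fun i : Fin l => v (s + (i : ℕ)) := by
  rw [seg, List.ofFn_eq_map, ← List.map_coe_finRange_eq_range, List.map_map]
  rfl

theorem seg_congr {v w : ℤ → M} {s : ℤ} {l : ℕ} (h : ∀ k : ℤ, s ≤ k → k < s + l → v k = w k) :
    seg v s l = seg w s l :=
  List.map_congr_left fun i hi => h _ (by omega) (by have := List.mem_range.1 hi; omega)

theorem seg_append_cons_seg (s : ℤ) (k l : ℕ) (w : M) :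
    seg v s k ++ w :: seg v (s + k + 1) l = seg (Function.update v (s + k) w) s (k + 1 + l) := by
  rw [seg_add, seg_succ', Function.update_self, List.append_assoc, List.singleton_append]
  congr 1
  · exact seg_congr fun i _ hi => (Function.update_of_ne hi.ne _ _).symm
  · rw [Nat.cast_succ, ← add_assoc]
    congr 1
    exact seg_congr fun i hi _ => (Function.update_of_ne (by omega) _ _).symm

end Segments

section SegmentDeterminants

variable {R : Type*} [CommRing R] {n : ℕ}

theorem listDet_two_seg (v : ℤ → Fin n → R) (b c : ℤ) {k l : ℕ} (h : k + l + 2 = n) :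
    listDet (seg v (b + 1) (k + 1) ++ seg v (c + 1) (l + 1)) *
        listDet (seg v b (k + 1) ++ seg v c (l + 1)) =
      listDet (seg v b (k + 1) ++ seg v (c + 1) (l + 1)) *
          listDet (seg v (b + 1) (k + 1) ++ seg v c (l + 1)) +
        listDet (seg v (b + 1) k ++ seg v c (l + 2)) *
          listDet (seg v b (k + 2) ++ seg v (c + 1) l) := by
  have plucker := listDet_plucker (seg v (b + 1) k ++ seg v (c + 1) l) (by simp; omega)
    (v b) (v c) (v (c + 1 + l)) (v (b + 1 + k))
  rw [seg_succ v b (k + 1), seg_succ v c (l + 1), seg_succ' v (b + 1), seg_succ' v (c + 1),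
    seg_succ v b, seg_succ v c]
  set C := seg v (b + 1) k
  set D := seg v (c + 1) l
  have front_b₁c₁ := listDet_append_cons_append_cons C D [] (v (b + 1 + k)) (v (c + 1 + l))
  have front_b₀c₀ := listDet_append_cons_append_cons [] C D (v b) (v c)
  have front_b₀c₁ := listDet_append_cons_append_cons [] (C ++ D) [] (v b) (v (c + 1 + l))
  have front_b₁c₀ := listDet_append_cons_append_cons C [] D (v (b + 1 + k)) (v c)
  have front_c₀c₁ := listDet_append_cons_append_cons C D [] (v c) (v (c + 1 + l))
  have front_b₀b₁ := listDet_append_cons_append_cons [] C D (v b) (v (b + 1 + k))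
  simp only [List.nil_append, List.append_nil, List.append_assoc, List.cons_append,
    List.length_append, List.length_nil, pow_zero, one_mul, pow_add] at *
  rw [front_b₁c₁, front_b₀c₀, front_b₀c₁, front_b₁c₀, front_c₀c₁, front_b₀b₁]
  linear_combination (-1) ^ C.length * (-1) ^ D.length * plucker

theorem listDet_three_seg (v : ℤ → Fin n → R) (a b c : ℤ) {p q r : ℕ} (h : p + q + r + 2 = n) :
    listDet (seg v a (p + 1) ++ (seg v b (q + 1) ++ seg v (c + 1) r)) *
        listDet (seg v (a + 1) (p + 1) ++ (seg v b q ++ seg v c (r + 1))) =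
      listDet (seg v a (p + 1) ++ (seg v b q ++ seg v c (r + 1))) *
          listDet (seg v (a + 1) (p + 1) ++ (seg v b (q + 1) ++ seg v (c + 1) r)) +
        listDet (seg v a (p + 2) ++ (seg v b q ++ seg v (c + 1) r)) *
          listDet (seg v (a + 1) p ++ (seg v b (q + 1) ++ seg v c (r + 1))) := by
  have plucker := listDet_plucker (seg v (a + 1) p ++ (seg v b q ++ seg v (c + 1) r))
    (by simp; omega) (v a) (v (b + q)) (v c) (v (a + 1 + p))
  rw [seg_succ v a (p + 1), seg_succ' v (a + 1), seg_succ v a, seg_succ' v b, seg_succ v c]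
  set C := seg v (a + 1) p
  set D := seg v b q
  set E := seg v (c + 1) r
  have front_a₀b₁ := listDet_append_cons_append_cons [] (C ++ D) E (v a) (v (b + q))
  have front_a₁c₀ := listDet_append_cons_append_cons C D E (v (a + 1 + p)) (v c)
  have front_a₀c₀ := listDet_append_cons_append_cons [] (C ++ D) E (v a) (v c)
  have front_a₁b₁ := listDet_append_cons_append_cons C D E (v (a + 1 + p)) (v (b + q))
  have front_a₀a₁ := listDet_append_cons_append_cons [] C (D ++ E) (v a) (v (a + 1 + p))
  have front_b₁c₀ := listDet_append_cons_append_cons (C ++ D) [] E (v (b + q)) (v c)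
  have square : ((-1 : R) ^ D.length) * (-1) ^ D.length = 1 := by rw [← mul_pow]; simp
  simp only [List.nil_append, List.append_assoc, List.cons_append,
    List.length_append, List.length_nil, pow_zero, one_mul, pow_add] at *
  rw [front_a₀b₁, front_a₁c₀, front_a₀c₀, front_a₁b₁, front_a₀a₁, front_b₁c₀]
  linear_combination (-1) ^ C.length * plucker + (-1) ^ C.length * square *
    (listDet (v a :: v (b + q) :: (C ++ (D ++ E))) *
      listDet (v (a + 1 + p) :: v c :: (C ++ (D ++ E))) -
    listDet (v a :: v c :: (C ++ (D ++ E))) *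
      listDet (v (a + 1 + p) :: v (b + q) :: (C ++ (D ++ E))))

theorem listDet_seg_append_of_quasiperiodic (v : ℤ → Fin n → R) (s d : ℤ) (k : ℕ)
    (l : List (Fin n → R)) (hl : k + l.length = n)
    (hv : ∀ i, s ≤ i → i < s + k → v i = (-1 : R) ^ (n - 1) • v (i + d)) :
    listDet (seg v s k ++ l) = listDet (l ++ seg v (s + d) k) := by
  induction k generalizing s l with
  | zero => simp
  | succ k ih =>
    have moved := ih (s + 1) (l ++ [v (s + d)]) (by simp; omega)
      (fun i h h' => hv i (by omega) (by push_cast; omega))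
    have last := listDet_append_cons (seg v (s + 1) k ++ l) [] (v (s + d))
    rw [List.length_append, length_seg, show k + l.length = n - 1 by omega] at last
    simp only [List.append_assoc, List.cons_append, List.nil_append, List.append_nil]
      at moved last
    rw [seg_succ, hv s le_rfl (by push_cast; omega), List.cons_append, listDet_smul_cons, ← last,
      moved, seg_succ, add_right_comm]

end SegmentDeterminants

section Solutions

/-- The recurrence of the half-octahedron `A₁`, in the coordinates `i = (n + x + t - y) / 2` and
`j = (n + x - t - y) / 2`. It is stated without division, so that it makes sense in a ring. -/
structure IsHalfOctSolution {K : Type*} [CommSemiring K] (n : ℕ) (G : ℕ → ℕ → ℕ → K) : Prop where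
  inner : ∀ i j y, i + y + 2 ≤ n → j + y + 2 ≤ n →
    G (i + 1) j (y + 1) * G i (j + 1) (y + 1) =
      G i j (y + 1) * G (i + 1) (j + 1) (y + 1) + G i j (y + 2) * G (i + 1) (j + 1) y
  wall : ∀ i j, i + 1 ≤ n → j + 1 ≤ n →
    G (i + 1) j 0 * G i (j + 1) 0 = G i j 0 * G (i + 1) (j + 1) 0

/-- The recurrence of the prism `A₂`, where the time is replaced by the coordinate
`a = (n + t - x - y) / 2`. It is stated without division, so that it makes sense in a ring. -/
structure IsPrismSolution {K : Type*} [CommSemiring K] (n : ℕ) (G : ℕ → ℕ → ℕ → K) : Prop where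
  inner : ∀ x y a, x + a + 2 ≤ n → y + 2 ≤ n →
    G (x + 1) (y + 1) (a + 1) * G (x + 1) (y + 1) a =
      G (x + 2) (y + 1) a * G x (y + 1) (a + 1) + G (x + 1) (y + 2) a * G (x + 1) y (a + 1)
  wall_bot : ∀ x a, x + a + 2 ≤ n →
    G (x + 1) 0 (a + 1) * G (x + 1) 0 a = G (x + 2) 0 a * G x 0 (a + 1)
  wall_top : ∀ x a, x + a + 2 ≤ n →
    G (x + 1) n (a + 1) * G (x + 1) n a = G (x + 2) n a * G x n (a + 1)
  wall_x : ∀ y a, a + 1 ≤ n → y + 2 ≤ n →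
    G 0 (y + 1) (a + 1) * G 0 (y + 1) a = G 0 (y + 2) a * G 0 y (a + 1)
  corner_bot : ∀ a, a + 1 ≤ n → G 0 0 (a + 1) * G 0 0 a = G 1 0 a * G 0 1 a
  corner_top : ∀ a, a + 1 ≤ n → G 0 n (a + 1) * G 0 n a = G 1 n a * G 0 (n - 1) (a + 1)

/-- The values of `G₁` on the lower boundary of `A₁` and of `G₂` on that of `A₂` agree under the
identification `s`. The two clauses are the triangles `x ≤ 0` and `x ≥ 0` of `S₁`. -/
structure LowerMatch {K : Type*} (n : ℕ) (G₁ G₂ : ℕ → ℕ → ℕ → K) : Prop where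
  left : ∀ x y, x + y ≤ n → G₂ x y 0 = G₁ 0 x y
  right : ∀ x y i, x ≤ n → y ≤ n → x + y = n + i → G₂ x y 0 = G₁ i x (n - x)

/-- The values of `G₁` on the upper boundary of `A₁` and of `G₂` on that of `A₂` agree under the
identification `s'`. The two clauses are the triangles `x ≥ 0` and `x ≤ 0` of `S₁'`. -/
structure UpperMatch {K : Type*} (n : ℕ) (G₁ G₂ : ℕ → ℕ → ℕ → K) : Prop where
  right : ∀ x y, x ≤ y → y ≤ n → G₂ x y (n - x) = G₁ y (y - x) (n - y)
  left : ∀ x y, y ≤ x → x ≤ n → G₂ x y (n - x) = G₁ y 0 (n - x)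

end Solutions

/-! ### Solutions made of minors -/

section Minors

variable {R : Type*} [CommRing R] {n : ℕ}

/-- The minors that solve the recurrence of `A₁`. When the vectors `v n, …, v (2 * n - 1)` are the
standard basis, they are, up to sign, the contiguous minors of the matrix with columns
`v 0, …, v (n - 1)`. -/
noncomputable def halfOctMinor (v : ℤ → Fin n → R) (i j y : ℕ) : R :=
  listDet (seg v j y ++ (seg v n i ++ seg v (n + i + y) (n - i - y)))

/-- The minors on two segments of a sequence of vectors, which solve the recurrence of `A₂`. -/
noncomputable def prismMinor (v : ℤ → Fin n → R) (x y a : ℕ) : R :=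
  listDet (seg v (a + y - n) (n - y) ++ seg v (a + x) y)

theorem halfOctMinor_eq (v : ℤ → Fin n → R) (i j y r : ℕ) (h : n = i + y + r) :
    halfOctMinor v i j y = listDet (seg v j y ++ (seg v n i ++ seg v (n + i + y) r)) := by
  rw [halfOctMinor, show n - i - y = r by omega]

theorem halfOctMinor_zero (v : ℤ → Fin n → R) {i : ℕ} (j : ℕ) (hi : i ≤ n) :
    halfOctMinor v i j 0 = listDet (seg v n n) := by
  rw [halfOctMinor, seg_zero, List.nil_append, seg_append _ (by simp),
    show i + (n - i - 0) = n by omega]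

theorem isHalfOctSolution_halfOctMinor (v : ℤ → Fin n → R) :
    IsHalfOctSolution n (halfOctMinor v) where
  inner i j y hi _ := by
    obtain ⟨r, hr⟩ := Nat.exists_eq_add_of_le hi
    rw [halfOctMinor_eq v (i + 1) j (y + 1) r (by omega),
      halfOctMinor_eq v i (j + 1) (y + 1) (r + 1) (by omega),
      halfOctMinor_eq v i j (y + 1) (r + 1) (by omega),
      halfOctMinor_eq v (i + 1) (j + 1) (y + 1) r (by omega),
      halfOctMinor_eq v i j (y + 2) r (by omega),
      halfOctMinor_eq v (i + 1) (j + 1) y (r + 1) (by omega)]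
    have key := listDet_three_seg v j n (n + i + y + 1) (p := y) (q := i) (r := r) (by omega)
    push_cast
    ring_nf at key ⊢
    exact key
  wall i j hi _ := by
    rw [halfOctMinor_zero v j hi, halfOctMinor_zero v _ (by omega),
      halfOctMinor_zero v j (by omega), halfOctMinor_zero v _ hi]

theorem prismMinor_eq (v : ℤ → Fin n → R) (x y a z : ℕ) (h : n = z + y) :
    prismMinor v x y a = listDet (seg v (a - z) z ++ seg v (a + x) y) := by
  subst h
  rw [prismMinor, Nat.add_sub_cancel]
  push_cast
  ring_nf

theorem prismMinor_zero_left (v : ℤ → Fin n → R) {y : ℕ} (a : ℕ) (hy : y ≤ n) :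
    prismMinor v 0 y a = listDet (seg v (a + y - n) n) := by
  rw [prismMinor, seg_append _ (by push_cast [hy]; ring), Nat.sub_add_cancel hy]

theorem prismMinor_zero (v : ℤ → Fin n → R) (x a : ℕ) :
    prismMinor v x 0 a = listDet (seg v (a - n) n) := by
  simp [prismMinor]

theorem prismMinor_self (v : ℤ → Fin n → R) (x a : ℕ) :
    prismMinor v x n a = listDet (seg v (a + x) n) := by
  simp [prismMinor]

theorem isPrismSolution_prismMinor (v : ℤ → Fin n → R) : IsPrismSolution n (prismMinor v) where
  inner x y a _ hy := by
    obtain ⟨z, hz⟩ := Nat.exists_eq_add_of_le hy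
    rw [prismMinor_eq v (x + 1) (y + 1) (a + 1) (z + 1) (by omega),
      prismMinor_eq v (x + 1) (y + 1) a (z + 1) (by omega),
      prismMinor_eq v (x + 2) (y + 1) a (z + 1) (by omega),
      prismMinor_eq v x (y + 1) (a + 1) (z + 1) (by omega),
      prismMinor_eq v (x + 1) (y + 2) a z (by omega),
      prismMinor_eq v (x + 1) y (a + 1) (z + 2) (by omega)]
    have key := listDet_two_seg v (a - z - 1) (a + x + 1) (k := z) (l := y) (by omega)
    push_cast
    ring_nf at key ⊢
    exact key
  wall_bot x a _ := by
    simp only [prismMinor_zero]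
    ring
  wall_top x a _ := by
    simp only [prismMinor_self]
    push_cast
    ring_nf
  wall_x y a _ hy := by
    rw [prismMinor_zero_left v _ (by omega), prismMinor_zero_left v _ (by omega),
      prismMinor_zero_left v _ (by omega), prismMinor_zero_left v _ (by omega)]
    push_cast
    ring_nf
  corner_bot a ha := by
    rw [prismMinor_zero_left v _ (by omega), prismMinor_zero_left v _ (by omega),
      prismMinor_zero_left v _ (by omega), prismMinor_zero]
    push_cast
    ring_nf
  corner_top a ha := by
    rw [prismMinor_zero_left v _ (by omega), prismMinor_self, prismMinor_self,
      prismMinor_zero_left v _ (by omega)]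
    push_cast [show 1 ≤ n by omega]
    ring_nf

theorem lowerMatch_minors (v : ℤ → Fin n → R)
    (hv : ∀ k : ℤ, -n ≤ k → k < 0 → v k = (-1 : R) ^ (n - 1) • v (k + 2 * n)) :
    LowerMatch n (halfOctMinor v) (prismMinor v) := by
  have rotate (x y : ℕ) (hy : y ≤ n) :
      prismMinor v x y 0 = listDet (seg v x y ++ seg v (n + y) (n - y)) := by
    rw [prismMinor, listDet_seg_append_of_quasiperiodic v ((0 : ℕ) + y - n) (2 * n) (n - y)
      (seg v ((0 : ℕ) + x) y) (by simp; omega) fun i h h' => hv i (by omega) (by omega)]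
    congr 3 <;> push_cast <;> ring
  refine ⟨fun x y h => ?_, fun x y i hx hy h => ?_⟩
  · rw [rotate x y (by omega)]
    simp [halfOctMinor]
  · rw [rotate x y hy, halfOctMinor, ← List.append_assoc,
      seg_append v (s := x) (t := n) (k := n - x) (by omega)]
    congr 3 <;> omega

theorem upperMatch_minors (v : ℤ → Fin n → R)
    (hv : ∀ k : ℤ, -n ≤ k → k < 0 → v k = (-1 : R) ^ (n - 1) • v (k + 2 * n)) :
    UpperMatch n (halfOctMinor v) (prismMinor v) := by
  refine ⟨fun x y hxy hy => ?_, fun x y hxy hx => ?_⟩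
  · rw [prismMinor, halfOctMinor, show n - y - (n - y) = 0 by omega, seg_zero, List.append_nil]
    congr 3 <;> omega
  · have split : seg v ((n - x : ℕ) + y - n) (n - y) =
        seg v ((y : ℤ) - x) (x - y) ++ seg v 0 (n - x) := by
      rw [seg_append _ (by omega)]
      congr 1 <;> omega
    rw [prismMinor, split, List.append_assoc,
      listDet_seg_append_of_quasiperiodic v (y - x) (2 * n) (x - y) _ (by simp; omega)
        fun i h h' => hv i (by omega) (by omega),
      halfOctMinor, List.append_assoc]
    congr 4 <;> omega

end Minors

section BlockColumns

variable {R : Type*} [CommRing R] {n : ℕ}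

/-- The columns `-n, …, 2 * n - 1` of the `n × 3n` matrix `((-1) ^ (n - 1) • 1 | M' | 1)`, where
`M'` is `M` with its rows multiplied by alternating signs. These signs cancel those of the minors
that represent the entries of `M`. -/
noncomputable def blockColumn (n : ℕ) (M : ℕ → ℕ → R) (k : ℤ) : Fin n → R :=
  if k < 0 then (-1 : R) ^ (n - 1) • fun i : Fin n => if k + n = (i : ℕ) then 1 else 0
  else if k < n then fun i => (-1) ^ (i : ℕ) * M i k.toNat
  else fun i => if k - n = (i : ℕ) then 1 else 0

theorem blockColumn_of_neg (M : ℕ → ℕ → R) (k : ℤ) (hk : -n ≤ k) (hk' : k < 0) :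
    blockColumn n M k = (-1 : R) ^ (n - 1) • blockColumn n M (k + 2 * n) := by
  rw [blockColumn, blockColumn, if_pos hk', if_neg (by omega), if_neg (by omega),
    show k + 2 * (n : ℤ) - n = k + n by ring]

theorem blockColumn_natCast (M : ℕ → ℕ → R) {j : ℕ} (hj : j < n) (i : Fin n) :
    blockColumn n M j i = (-1) ^ (i : ℕ) * M i j := by
  rw [blockColumn, if_neg (by omega), if_pos (by omega), Int.toNat_natCast]

theorem blockColumn_add (M : ℕ → ℕ → R) (i j : Fin n) :
    blockColumn n M (n + (i : ℕ)) j = (1 : Matrix (Fin n) (Fin n) R) i j := by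
  rw [blockColumn, if_neg (by omega), if_neg (by omega), add_sub_cancel_left, Matrix.one_apply]
  simp only [Nat.cast_inj, Fin.ext_iff]

theorem det_one_updateRow {ι : Type*} [Fintype ι] [DecidableEq ι] (i : ι) (w : ι → R) :
    ((1 : Matrix ι ι R).updateRow i w).det = w i := by
  rw [← Matrix.cramer_transpose_apply, Matrix.transpose_one, Matrix.cramer_one]
  rfl

theorem halfOctMinor_blockColumn_zero (M : ℕ → ℕ → R) {i : ℕ} (j : ℕ) (hi : i ≤ n) :
    halfOctMinor (blockColumn n M) i j 0 = 1 := by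
  rw [halfOctMinor_zero _ j hi, seg_eq_ofFn, listDet_ofFn, ← Matrix.det_one (n := Fin n) (R := R)]
  congr 1
  ext k l
  exact blockColumn_add M k l

theorem halfOctMinor_blockColumn_one (M : ℕ → ℕ → R) {i j : ℕ} (hi : i < n) (hj : j < n) :
    halfOctMinor (blockColumn n M) i j 1 = M i j := by
  set v := blockColumn n M with hv
  have rows : Matrix.of (fun k : Fin n => Function.update v (n + i) (v j) (n + (k : ℕ))) =
      (1 : Matrix (Fin n) (Fin n) R).updateRow ⟨i, hi⟩ (v j) := by
    ext k l
    by_cases hk : (k : ℕ) = i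
    · simp [Matrix.updateRow_apply, Fin.ext_iff, hk]
    · simp [Matrix.updateRow_apply, Fin.ext_iff, hk, hv, blockColumn_add]
  have minor : listDet (seg v n i ++ v j :: seg v (n + i + 1) (n - i - 1)) = v j ⟨i, hi⟩ := by
    rw [seg_append_cons_seg, show i + 1 + (n - i - 1) = n by omega, seg_eq_ofFn, listDet_ofFn,
      rows, det_one_updateRow]
  rw [listDet_append_cons, length_seg, hv, blockColumn_natCast M hj, ← hv] at minor
  simp only [halfOctMinor, seg_succ, seg_zero, List.cons_append, List.nil_append, Nat.cast_one]
  have square : ((-1 : R) ^ i) * (-1) ^ i = 1 := by rw [← mul_pow]; simp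
  linear_combination (-1) ^ i * minor -
    (listDet (v j :: (seg v n i ++ seg v (n + i + 1) (n - i - 1))) - M i j) * square

end BlockColumns

section Uniqueness

variable {K : Type*} [CommRing K] [IsDomain K] {n : ℕ}

theorem IsHalfOctSolution.eq_of_eq {G H : ℕ → ℕ → ℕ → K} (hG : IsHalfOctSolution n G)
    (hH : IsHalfOctSolution n H) (hne : ∀ i j y, G i j y ≠ 0)
    (h₀ : ∀ i j, i ≤ n → j ≤ n → G i j 0 = H i j 0)
    (h₁ : ∀ i j, i < n → j < n → G i j 1 = H i j 1) (y : ℕ) :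
    ∀ i j, i + y ≤ n → j + y ≤ n → G i j y = H i j y := by
  induction y using Nat.twoStepInduction with
  | zero => exact h₀
  | one => exact h₁
  | more y ih ih' =>
    intro i j hi hj
    have ruleG := hG.inner i j y (by omega) (by omega)
    have ruleH := hH.inner i j y (by omega) (by omega)
    rw [← ih' (i + 1) j (by omega) (by omega), ← ih' i (j + 1) (by omega) (by omega),
      ← ih' i j (by omega) (by omega), ← ih' (i + 1) (j + 1) (by omega) (by omega),
      ← ih (i + 1) (j + 1) (by omega) (by omega)] at ruleH
    exact mul_right_cancel₀ (hne (i + 1) (j + 1) y) (add_left_cancel (ruleG.symm.trans ruleH))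

theorem IsPrismSolution.eq_succ_zero_of_eq {G H : ℕ → ℕ → ℕ → K} (hG : IsPrismSolution n G)
    (hH : IsPrismSolution n H) (hne : ∀ x y a, G x y a ≠ 0) {a : ℕ} (ha : a + 1 ≤ n)
    (h : ∀ x y, x + a ≤ n → y ≤ n → G x y a = H x y a) {y : ℕ} (hy : y ≤ n) :
    G 0 y (a + 1) = H 0 y (a + 1) := by
  have cancel {y : ℕ} (hy : y ≤ n)
      (rule : G 0 y (a + 1) * G 0 y a = H 0 y (a + 1) * H 0 y a) :
      G 0 y (a + 1) = H 0 y (a + 1) :=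
    mul_right_cancel₀ (hne 0 y a) (by rwa [← h 0 y (by omega) hy] at rule)
  induction y with
  | zero =>
    refine cancel hy ?_
    rw [hG.corner_bot a ha, hH.corner_bot a ha, h 1 0 (by omega) hy, h 0 1 (by omega) (by omega)]
  | succ y ihy =>
    refine cancel hy ?_
    rcases hy.lt_or_eq with hy | rfl
    · rw [hG.wall_x y a ha hy, hH.wall_x y a ha hy, h 0 (y + 2) (by omega) hy, ihy (by omega)]
    · rw [hG.corner_top a ha, hH.corner_top a ha, Nat.add_sub_cancel,
        h 1 (y + 1) (by omega) le_rfl, ihy (by omega)]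

theorem IsPrismSolution.eq_succ_of_eq {G H : ℕ → ℕ → ℕ → K} (hG : IsPrismSolution n G)
    (hH : IsPrismSolution n H) (hne : ∀ x y a, G x y a ≠ 0) {a : ℕ}
    (h : ∀ x y, x + a ≤ n → y ≤ n → G x y a = H x y a) :
    ∀ x y, x + (a + 1) ≤ n → y ≤ n → G x y (a + 1) = H x y (a + 1) := by
  have cancel {x y : ℕ} (hx : x + a ≤ n) (hy : y ≤ n)
      (rule : G x y (a + 1) * G x y a = H x y (a + 1) * H x y a) :
      G x y (a + 1) = H x y (a + 1) :=
    mul_right_cancel₀ (hne x y a) (by rwa [← h x y hx hy] at rule)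
  intro x
  induction x with
  | zero => exact fun y ha hy => hG.eq_succ_zero_of_eq hH hne (by omega) h hy
  | succ x ihx =>
    intro y hx
    induction y with
    | zero =>
      intro hy
      refine cancel (by omega) (by omega) ?_
      rw [hG.wall_bot x a (by omega), hH.wall_bot x a (by omega),
        h (x + 2) 0 (by omega) (by omega), ihx 0 (by omega) (by omega)]
    | succ y ihy =>
      intro hy
      refine cancel (by omega) (by omega) ?_
      rcases hy.lt_or_eq with hy | rfl
      · rw [hG.inner x y a (by omega) (by omega), hH.inner x y a (by omega) (by omega),
          h (x + 2) (y + 1) (by omega) (by omega), ihx (y + 1) (by omega) (by omega),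
          h (x + 1) (y + 2) (by omega) (by omega), ihy (by omega)]
      · rw [hG.wall_top x a (by omega), hH.wall_top x a (by omega),
          h (x + 2) (y + 1) (by omega) (by omega), ihx (y + 1) (by omega) (by omega)]

theorem IsPrismSolution.eq_of_eq {G H : ℕ → ℕ → ℕ → K} (hG : IsPrismSolution n G)
    (hH : IsPrismSolution n H) (hne : ∀ x y a, G x y a ≠ 0)
    (h₀ : ∀ x y, x ≤ n → y ≤ n → G x y 0 = H x y 0) (a : ℕ) :
    ∀ x y, x + a ≤ n → y ≤ n → G x y a = H x y a := by
  induction a with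
  | zero => exact h₀
  | succ a ih => exact hG.eq_succ_of_eq hH hne ih

theorem upperMatch_of_normalized {G₁ G₂ : ℕ → ℕ → ℕ → K}
    (h₁ : IsHalfOctSolution n G₁) (h₂ : IsPrismSolution n G₂) (hne₁ : ∀ i j y, G₁ i j y ≠ 0)
    (hne₂ : ∀ x y a, G₂ x y a ≠ 0) (h₀ : ∀ i j, i ≤ n → j ≤ n → G₁ i j 0 = 1)
    (hlow : LowerMatch n G₁ G₂) : UpperMatch n G₁ G₂ := by
  let M (i j : ℕ) : K := G₁ i j 1
  let v := blockColumn n M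
  have hv := blockColumn_of_neg (n := n) M
  have eq₁ := h₁.eq_of_eq (isHalfOctSolution_halfOctMinor v) hne₁
    (fun i j hi hj => by rw [h₀ i j hi hj, halfOctMinor_blockColumn_zero M j hi])
    fun i j hi hj => (halfOctMinor_blockColumn_one M hi hj).symm
  have low := lowerMatch_minors v hv
  have eq₂ := h₂.eq_of_eq (isPrismSolution_prismMinor v) hne₂ fun x y hx hy => by
    rcases Nat.le_total (x + y) n with h | h
    · rw [hlow.left x y h, low.left x y h, eq₁ y 0 x (by omega) (by omega)]
    · obtain ⟨i, hi⟩ := Nat.exists_eq_add_of_le h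
      rw [hlow.right x y i hx hy hi, low.right x y i hx hy hi, eq₁ _ i x (by omega) (by omega)]
  have up := upperMatch_minors v hv
  refine ⟨fun x y hxy hy => ?_, fun x y hxy hx => ?_⟩
  · rw [eq₂ _ x y (by omega) hy, up.right x y hxy hy, eq₁ _ _ _ (by omega) (by omega)]
  · rw [eq₂ _ x y (by omega) (by omega), up.left x y hxy hx, eq₁ _ _ _ (by omega) (by omega)]

end Uniqueness

section Gauge

theorem IsHalfOctSolution.gauge {K : Type*} [CommRing K] {n : ℕ} {G : ℕ → ℕ → ℕ → K}
    (hG : IsHalfOctSolution n G) (α β : ℕ → K) :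
    IsHalfOctSolution n fun i j y => α i * β (j + y) * G i j y where
  inner i j y hi hj := by
    linear_combination (norm := ring_nf)
      (α i * α (i + 1) * β (j + y + 1) * β (j + y + 2)) * hG.inner i j y hi hj
  wall i j hi hj := by
    linear_combination (norm := ring_nf)
      (α i * α (i + 1) * β j * β (j + 1)) * hG.wall i j hi hj

theorem IsPrismSolution.gauge {K : Type*} [CommRing K] {n : ℕ} {G : ℕ → ℕ → ℕ → K}
    (hG : IsPrismSolution n G) (c : K) (δ : ℕ → K) :
    IsPrismSolution n fun x y a => c * δ a * δ (x + y + a) * G x y a where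
  inner x y a hx hy := by
    linear_combination (norm := ring_nf)
      (c ^ 2 * δ (x + y + a + 3) * δ (x + y + a + 2) * δ a * δ (a + 1)) * hG.inner x y a hx hy
  wall_bot x a hx := by
    linear_combination (norm := ring_nf)
      (c ^ 2 * δ (x + a + 2) * δ (x + a + 1) * δ a * δ (a + 1)) * hG.wall_bot x a hx
  wall_top x a hx := by
    linear_combination (norm := ring_nf)
      (c ^ 2 * δ (x + n + a + 2) * δ (x + n + a + 1) * δ a * δ (a + 1)) * hG.wall_top x a hx
  wall_x y a ha hy := by
    linear_combination (norm := ring_nf)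
      (c ^ 2 * δ (y + a + 2) * δ (y + a + 1) * δ a * δ (a + 1)) * hG.wall_x y a ha hy
  corner_bot a ha := by
    linear_combination (norm := ring_nf)
      (c ^ 2 * δ (a + 1) ^ 2 * δ a ^ 2) * hG.corner_bot a ha
  corner_top a ha := by
    rw [show 0 + (n - 1) + (a + 1) = n + a by omega]
    linear_combination (norm := ring_nf)
      (c ^ 2 * δ (n + a + 1) * δ (n + a) * δ a * δ (a + 1)) * hG.corner_top a ha

/-- The values of `G` where the wall `y = 0` meets the lower boundary of `A₁`, in the order of
increasing `x`. -/
def lowerWallValue {K : Type*} (n : ℕ) (G : ℕ → ℕ → ℕ → K) (k : ℕ) : K :=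
  G (k - n) (min k n) 0

theorem lowerWallValue_of_le {K : Type*} {n : ℕ} (G : ℕ → ℕ → ℕ → K) {k : ℕ} (hk : k ≤ n) :
    lowerWallValue n G k = G 0 k 0 := by
  simp [lowerWallValue, hk]

theorem lowerWallValue_add {K : Type*} (n : ℕ) (G : ℕ → ℕ → ℕ → K) (i : ℕ) :
    lowerWallValue n G (i + n) = G i n 0 := by
  simp [lowerWallValue]

theorem IsHalfOctSolution.wall_mul_eq {K : Type*} [CommRing K] [IsDomain K] {n : ℕ}
    {G : ℕ → ℕ → ℕ → K} (hG : IsHalfOctSolution n G) (hne : ∀ i j y, G i j y ≠ 0) {i j : ℕ}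
    (hi : i ≤ n) (hj : j ≤ n) :
    G i j 0 * G 0 n 0 = G i n 0 * G 0 j 0 := by
  have adjacent_rows {i j : ℕ} (hi : i + 1 ≤ n) (hj : j ≤ n) :
      G (i + 1) j 0 * G i n 0 = G i j 0 * G (i + 1) n 0 := by
    induction hj using Nat.decreasingInduction with
    | self => rw [mul_comm]
    | of_succ j hj ih =>
      refine mul_right_cancel₀ (hne i (j + 1) 0) ?_
      linear_combination G i n 0 * hG.wall i j hi hj + G i j 0 * ih
  induction i with
  | zero => rw [mul_comm]
  | succ i ih =>
    refine mul_right_cancel₀ (hne i n 0) ?_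
    linear_combination G 0 n 0 * adjacent_rows hi hj + G (i + 1) n 0 * ih (by omega)

theorem upperMatch_of_lowerMatch {K : Type*} [Field K] {n : ℕ} {G₁ G₂ : ℕ → ℕ → ℕ → K}
    (h₁ : IsHalfOctSolution n G₁) (h₂ : IsPrismSolution n G₂) (hne₁ : ∀ i j y, G₁ i j y ≠ 0)
    (hne₂ : ∀ x y a, G₂ x y a ≠ 0) (hlow : LowerMatch n G₁ G₂) :
    UpperMatch n (fun i j y => G₁ i j y * G₁ 0 n 0) (fun x y a => G₂ x y a * G₁ 0 0 0) := by
  set ε := lowerWallValue n G₁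
  have hε (k) : ε k ≠ 0 := hne₁ _ _ _
  have ε_of_le {k} (hk : k ≤ n) : ε k = G₁ 0 k 0 := lowerWallValue_of_le G₁ hk
  have normalized := upperMatch_of_normalized
    (h₁.gauge (fun i => ε n * (ε (i + n))⁻¹) fun k => (ε k)⁻¹)
    (h₂.gauge (ε 0) fun k => (ε k)⁻¹)
    (fun i j y => by simp [hε, hne₁]) (fun x y a => by simp [hε, hne₂])
    (fun i j hi hj => by
      have wall := h₁.wall_mul_eq hne₁ hi hj
      rw [← ε_of_le le_rfl, ← ε_of_le hj, ← lowerWallValue_add n G₁ i] at wall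
      have := hε (i + n)
      have := hε j
      rw [add_zero]
      field_simp
      linear_combination wall)
    ⟨fun x y h => by simp [hlow.left x y h, hε],
      fun x y i hx hy h => by
        simp [hlow.right x y i hx hy h, hε, h, Nat.add_sub_of_le hx, add_comm i n,
          mul_right_comm _ (ε (n + i))⁻¹]⟩
  rw [← ε_of_le le_rfl, ← ε_of_le (Nat.zero_le n)]
  have cancel {b c : K} (k l : ℕ)
      (h : ε 0 * (ε l)⁻¹ * (ε k)⁻¹ * b = ε n * (ε k)⁻¹ * (ε l)⁻¹ * c) : b * ε 0 = c * ε n := by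
    have := hε k
    have := hε l
    field_simp at h
    linear_combination h
  refine ⟨fun x y hxy hy => cancel (y + n) (n - x) ?_, fun x y hxy hx => cancel (y + n) (n - x) ?_⟩
  · have h := normalized.right x y hxy hy
    rwa [show x + y + (n - x) = y + n by omega, show y - x + (n - y) = n - x by omega] at h
  · have h := normalized.left x y hxy hx
    rwa [show x + y + (n - x) = y + n by omega, zero_add] at h

end Gauge

/-! ### Subtraction-free rational functions -/

section SubtractionFree

variable {F : Type*} [PosSemifield F]

instance withZeroCommSemiring : CommSemiring (WithZero F) where
  __ := (inferInstance : AddCommMonoid (WithZero F))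
  __ := (inferInstance : CommMonoidWithZero (WithZero F))
  __ := (inferInstance : Distrib (WithZero F))

/-- The field of rational functions over `ℚ` in the variables `σ`. -/
abbrev RationalFunctions (σ : Type*) : Type _ := FractionRing (MvPolynomial σ ℤ)

/-- The embedding of the polynomials with coefficients in `ℕ` into the rational functions. -/
noncomputable def toRat (σ : Type*) : MvPolynomial σ ℕ →+* RationalFunctions σ :=
  (algebraMap (MvPolynomial σ ℤ) (RationalFunctions σ)).comp (MvPolynomial.map (Nat.castRingHom ℤ))

theorem toRat_injective (σ : Type*) : Function.Injective (toRat σ) :=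
  (IsFractionRing.injective (MvPolynomial σ ℤ) (RationalFunctions σ)).comp
    (MvPolynomial.map_injective _ Nat.cast_injective)

variable {σ : Type*} (g : σ → F)

/-- The value of a polynomial with coefficients in `ℕ` at the point `g` of `F ^ σ`. A zero is
adjoined to `F` as the value of the zero polynomial. -/
noncomputable def evalAt : MvPolynomial σ ℕ →+* WithZero F :=
  MvPolynomial.eval₂Hom (Nat.castRingHom _) fun i => (g i : WithZero F)

variable {g} in
theorem toRat_ne_zero {P : MvPolynomial σ ℕ} (h : evalAt g P ≠ 0) : toRat σ P ≠ 0 := by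
  rw [map_ne_zero_iff _ (toRat_injective σ)]
  rintro rfl
  exact h (map_zero _)

/-- `P / Q` is a subtraction-free expression of the rational function `u` that takes the value `a`
at `g`. -/
structure IsExpression (u : RationalFunctions σ) (a : F) (P Q : MvPolynomial σ ℕ) : Prop where
  den_ne_zero : evalAt g Q ≠ 0
  mul_den : u * toRat σ Q = toRat σ P
  value_mul_den : (a : WithZero F) * evalAt g Q = evalAt g P

namespace IsExpression

variable {g} {u w : RationalFunctions σ} {a b : F} {P Q P' Q' : MvPolynomial σ ℕ}

theorem num_ne_zero (h : IsExpression g u a P Q) : evalAt g P ≠ 0 :=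
  h.value_mul_den ▸ mul_ne_zero WithZero.coe_ne_zero h.den_ne_zero

theorem ne_zero (h : IsExpression g u a P Q) : u ≠ 0 := by
  rintro rfl
  exact toRat_ne_zero h.num_ne_zero (by rw [← h.mul_den, zero_mul])

theorem value_unique (h : IsExpression g u a P Q) (h' : IsExpression g u b P' Q') : a = b := by
  have cross_mul : P * Q' = P' * Q := by
    refine toRat_injective σ ?_
    rw [map_mul, map_mul, ← h.mul_den, ← h'.mul_den]
    ring
  have cross_mul_eval := congrArg (evalAt g) cross_mul
  rw [map_mul, map_mul, ← h.value_mul_den, ← h'.value_mul_den, mul_assoc, mul_assoc,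
    mul_comm (evalAt g Q')] at cross_mul_eval
  exact WithZero.coe_injective
    (mul_right_cancel₀ (mul_ne_zero h.den_ne_zero h'.den_ne_zero) cross_mul_eval)

protected theorem one : IsExpression g 1 1 1 1 := ⟨by simp, by simp, by simp⟩

protected theorem X (i : σ) : IsExpression g (toRat σ (.X i)) (g i) (.X i) 1 :=
  ⟨by simp, by simp, by simp [evalAt]⟩

protected theorem mul (h : IsExpression g u a P Q) (h' : IsExpression g w b P' Q') :
    IsExpression g (u * w) (a * b) (P * P') (Q * Q') where
  den_ne_zero := by
    rw [map_mul]
    exact mul_ne_zero h.den_ne_zero h'.den_ne_zero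
  mul_den := by
    rw [map_mul, map_mul, mul_mul_mul_comm, h.mul_den, h'.mul_den]
  value_mul_den := by
    rw [map_mul, map_mul, WithZero.coe_mul, mul_mul_mul_comm, h.value_mul_den, h'.value_mul_den]

protected theorem add (h : IsExpression g u a P Q) (h' : IsExpression g w b P' Q') :
    IsExpression g (u + w) (a + b) (P * Q' + Q * P') (Q * Q') where
  den_ne_zero := (h.mul h').den_ne_zero
  mul_den := by
    simp only [map_mul, map_add, ← h.mul_den, ← h'.mul_den]
    ring
  value_mul_den := by
    simp only [map_mul, map_add, ← h.value_mul_den, ← h'.value_mul_den, WithZero.coe_add]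
    ring

protected theorem inv (h : IsExpression g u a P Q) : IsExpression g u⁻¹ a⁻¹ Q P where
  den_ne_zero := h.num_ne_zero
  mul_den := by rw [← h.mul_den, inv_mul_cancel_left₀ h.ne_zero]
  value_mul_den := by
    rw [← h.value_mul_den, ← mul_assoc, ← WithZero.coe_mul, inv_mul_cancel, WithZero.coe_one,
      one_mul]

end IsExpression

/-- The pairs that consist of a rational function with a subtraction-free expression and of its
value at `g`. They form a semifield, which embeds into a field through the first component and maps
to `F` through the second one. -/
def valueSubgroup : Subgroup ((RationalFunctions σ)ˣ × F) where
  carrier := {p | ∃ P Q, IsExpression g (p.1 : RationalFunctions σ) p.2 P Q}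
  mul_mem' := fun ⟨_, _, h⟩ ⟨_, _, h'⟩ => ⟨_, _, h.mul h'⟩
  one_mem' := ⟨_, _, .one⟩
  inv_mem' := by
    rintro _ ⟨P, Q, h⟩
    exact ⟨_, _, by simpa using h.inv⟩

noncomputable instance : Add (valueSubgroup g) where
  add p q := ⟨(Units.mk0 (p.1.1 + q.1.1) (by
      obtain ⟨_, _, h⟩ := p.2
      obtain ⟨_, _, h'⟩ := q.2
      exact (h.add h').ne_zero), p.1.2 + q.1.2), by
    obtain ⟨_, _, h⟩ := p.2
    obtain ⟨_, _, h'⟩ := q.2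
    exact ⟨_, _, h.add h'⟩⟩

namespace valueSubgroup

/-- The rational function of a pair. -/
noncomputable def toRationalFunctions : valueSubgroup g →* RationalFunctions σ :=
  ((Units.coeHom _).comp (MonoidHom.fst _ _)).comp (valueSubgroup g).subtype

/-- The value of a pair. -/
noncomputable def value : valueSubgroup g →* F :=
  (MonoidHom.snd _ _).comp (valueSubgroup g).subtype

theorem toRationalFunctions_add (p q : valueSubgroup g) :
    toRationalFunctions g (p + q) = toRationalFunctions g p + toRationalFunctions g q := rfl

theorem value_add (p q : valueSubgroup g) : value g (p + q) = value g p + value g q := rfl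

theorem toRationalFunctions_injective : Function.Injective (toRationalFunctions g) := by
  rintro ⟨⟨u, a⟩, P, Q, h⟩ ⟨⟨w, b⟩, P', Q', h'⟩ e
  obtain rfl : u = w := Units.ext e
  obtain rfl : a = b := h.value_unique h'
  rfl

noncomputable instance : PosSemifield (valueSubgroup g) where
  __ := (inferInstance : CommGroup (valueSubgroup g))
  __ := (inferInstance : Add (valueSubgroup g))
  add_assoc a b c :=
    toRationalFunctions_injective g (by simp only [toRationalFunctions_add, add_assoc])
  add_comm a b := toRationalFunctions_injective g (by simp only [toRationalFunctions_add, add_comm])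
  left_distrib a b c :=
    toRationalFunctions_injective g (by simp only [toRationalFunctions_add, map_mul, mul_add])
  right_distrib a b c :=
    toRationalFunctions_injective g (by simp only [toRationalFunctions_add, map_mul, add_mul])

/-- The variable `i` with its value `g i`. -/
noncomputable def coord (i : σ) : valueSubgroup g :=
  ⟨(Units.mk0 (toRat σ (.X i)) (IsExpression.X (g := g) i).ne_zero, g i), _, _, .X i⟩

end valueSubgroup

end SubtractionFree

section Map

variable {F R : Type*} [PosSemifield F] [PosSemifield R] (π : R →* F)

theorem IsRecurrent.map (hadd : ∀ a b, π (a + b) = π a + π b) {n : ℤ} {I J : Set ℝ}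
    {A : Set (ℝ × ℝ × ℝ)} {f : State n A R} (hf : IsRecurrent n I J A f) :
    IsRecurrent n I J A (fun p => π (f p)) where
  inner x y t hI hJ hu hd hx hx' hy hy' := by
    simp only [hf.inner x y t hI hJ hu hd hx hx' hy hy', map_div, map_mul, hadd]
  wall_y x y t hI hJ hu hd hx hx' := by
    simp only [hf.wall_y x y t hI hJ hu hd hx hx', map_div, map_mul]
  wall_x x y t hI hJ hu hd hy hy' := by
    simp only [hf.wall_x x y t hI hJ hu hd hy hy', map_div, map_mul]
  corner x y t σ τ hI hJ hσ hτ hxI hyJ hu hd hx hy := by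
    simp only [hf.corner x y t σ τ hI hJ hσ hτ hxI hyJ hu hd hx hy, map_div, map_mul]

theorem evolution_map (hadd : ∀ a b, π (a + b) = π a + π b) {n : ℤ} {I J : Set ℝ}
    {A S S' : Set (ℝ × ℝ × ℝ)} {hS : S ⊆ A} (hS' : S' ⊆ A) (h : WellPosed n I J hS F)
    (h' : WellPosed n I J hS R) (g : State n S R) :
    evolution hS' h (fun q => π (g q)) = fun p => π (evolution hS' h' g p) := by
  obtain ⟨solution, extends_g⟩ := (h' g).choose_spec.1
  have unique := (h fun q => π (g q)).choose_spec.2 _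
    ⟨solution.map π hadd, funext fun q => congrArg π (congrFun extends_g q)⟩
  exact congrArg (restrict hS') unique.symm

end Map

/-! ### Integer coordinates -/

section ExtendOne

variable {R K : Type*} [PosSemifield R] [Field K] (ν : R →* K)
  {n : ℤ} {I J : Set ℝ} {A : Set (ℝ × ℝ × ℝ)} {f : State n A R}

open Classical in
/-- A state with values mapped to a field, extended by one to all points. The value one keeps the
extension nowhere zero. -/
noncomputable def extendOne (f : State n A R) (p : ℝ × ℝ × ℝ) : K :=
  if h : p ∈ A ∩ lattice n then ν (f ⟨p, h⟩) else 1

theorem extendOne_of_mem (f : State n A R) {p : ℝ × ℝ × ℝ} (h : p ∈ A ∩ lattice n) :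
    extendOne ν f p = ν (f ⟨p, h⟩) :=
  dif_pos h

theorem extendOne_ne_zero (f : State n A R) (p : ℝ × ℝ × ℝ) : extendOne ν f p ≠ 0 := by
  rw [extendOne]
  split_ifs
  · exact ((Group.isUnit _).map ν).ne_zero
  · exact one_ne_zero

namespace IsRecurrent

variable {x y t : ℝ} {u d e w k l : ℝ × ℝ × ℝ}

theorem extendOne_inner (hf : IsRecurrent n I J A f) (hadd : ∀ a b, ν (a + b) = ν a + ν b)
    (hI : x ∈ interior I) (hJ : y ∈ interior J)
    (hu : u ∈ A ∩ lattice n) (hd : d ∈ A ∩ lattice n) (he : e ∈ A ∩ lattice n)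
    (hw : w ∈ A ∩ lattice n) (hk : k ∈ A ∩ lattice n) (hl : l ∈ A ∩ lattice n)
    (u_eq : u = (x, y, t + 1)) (d_eq : d = (x, y, t - 1)) (e_eq : e = (x + 1, y, t))
    (w_eq : w = (x - 1, y, t)) (k_eq : k = (x, y + 1, t)) (l_eq : l = (x, y - 1, t)) :
    extendOne ν f u * extendOne ν f d =
      extendOne ν f e * extendOne ν f w + extendOne ν f k * extendOne ν f l := by
  subst u_eq d_eq e_eq w_eq k_eq l_eq
  rw [extendOne_of_mem ν f hu, extendOne_of_mem ν f hd, extendOne_of_mem ν f he,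
    extendOne_of_mem ν f hw, extendOne_of_mem ν f hk, extendOne_of_mem ν f hl,
    hf.inner x y t hI hJ hu hd he hw hk hl, ← map_mul, div_mul_cancel, hadd, map_mul, map_mul]

theorem extendOne_wall_y (hf : IsRecurrent n I J A f) (hI : x ∈ interior I)
    (hJ : y ∈ J \ interior J)
    (hu : u ∈ A ∩ lattice n) (hd : d ∈ A ∩ lattice n) (he : e ∈ A ∩ lattice n)
    (hw : w ∈ A ∩ lattice n)
    (u_eq : u = (x, y, t + 1)) (d_eq : d = (x, y, t - 1)) (e_eq : e = (x + 1, y, t))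
    (w_eq : w = (x - 1, y, t)) :
    extendOne ν f u * extendOne ν f d = extendOne ν f e * extendOne ν f w := by
  subst u_eq d_eq e_eq w_eq
  rw [extendOne_of_mem ν f hu, extendOne_of_mem ν f hd, extendOne_of_mem ν f he,
    extendOne_of_mem ν f hw, hf.wall_y x y t hI hJ hu hd he hw, ← map_mul, div_mul_cancel, map_mul]

theorem extendOne_wall_x (hf : IsRecurrent n I J A f) (hI : x ∈ I \ interior I)
    (hJ : y ∈ interior J)
    (hu : u ∈ A ∩ lattice n) (hd : d ∈ A ∩ lattice n) (hk : k ∈ A ∩ lattice n)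
    (hl : l ∈ A ∩ lattice n)
    (u_eq : u = (x, y, t + 1)) (d_eq : d = (x, y, t - 1)) (k_eq : k = (x, y + 1, t))
    (l_eq : l = (x, y - 1, t)) :
    extendOne ν f u * extendOne ν f d = extendOne ν f k * extendOne ν f l := by
  subst u_eq d_eq k_eq l_eq
  rw [extendOne_of_mem ν f hu, extendOne_of_mem ν f hd, extendOne_of_mem ν f hk,
    extendOne_of_mem ν f hl, hf.wall_x x y t hI hJ hu hd hk hl, ← map_mul, div_mul_cancel, map_mul]

theorem extendOne_corner (hf : IsRecurrent n I J A f) (σ τ : ℝ) (hI : x ∈ I \ interior I)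
    (hJ : y ∈ J \ interior J) (hσ : σ = 1 ∨ σ = -1) (hτ : τ = 1 ∨ τ = -1) (hσI : x + σ ∈ I)
    (hτJ : y + τ ∈ J)
    (hu : u ∈ A ∩ lattice n) (hd : d ∈ A ∩ lattice n) (he : e ∈ A ∩ lattice n)
    (hk : k ∈ A ∩ lattice n)
    (u_eq : u = (x, y, t + 1)) (d_eq : d = (x, y, t - 1)) (e_eq : e = (x + σ, y, t))
    (k_eq : k = (x, y + τ, t)) :
    extendOne ν f u * extendOne ν f d = extendOne ν f e * extendOne ν f k := by
  subst u_eq d_eq e_eq k_eq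
  rw [extendOne_of_mem ν f hu, extendOne_of_mem ν f hd, extendOne_of_mem ν f he,
    extendOne_of_mem ν f hk, hf.corner x y t σ τ hI hJ hσ hτ hσI hτJ hu hd he hk,
    ← map_mul, div_mul_cancel, map_mul]

end IsRecurrent

end ExtendOne

section Coordinates

/-- The point of `A₁` with the coordinates `i = (n + x + t - y) / 2`, `j = (n + x - t - y) / 2`
and `y`. -/
def halfOctPoint (n i j y : ℕ) : ℝ × ℝ × ℝ := ((i : ℝ) + j + y - n, (y : ℝ), (i : ℝ) - j)

/-- The point of `A₂` with the coordinates `x`, `y` and `a = (n + t - x - y) / 2`. -/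
def prismPoint (n x y a : ℕ) : ℝ × ℝ × ℝ := ((x : ℝ), (y : ℝ), (x : ℝ) + y + 2 * a - n)

theorem halfOctPoint_mem_lattice (n i j y : ℕ) : halfOctPoint n i j y ∈ lattice n :=
  ⟨i + j + y - n, y, i - j, by simp [halfOctPoint], ⟨i + y - n, by ring⟩⟩

theorem prismPoint_mem_lattice (n x y a : ℕ) : prismPoint n x y a ∈ lattice n :=
  ⟨x, y, x + y + 2 * a - n, by simp [prismPoint], ⟨x + y + a - n, by ring⟩⟩

theorem halfOctPoint_mem {n i j y : ℕ} (hi : i + y ≤ n) (hj : j + y ≤ n) :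
    halfOctPoint n i j y ∈ A₁ n ∩ lattice n := by
  refine ⟨?_, halfOctPoint_mem_lattice n i j y⟩
  rw [halfOctPoint, mem_A₁]
  rify at hi hj
  refine ⟨y.cast_nonneg, ?_, ?_, ?_, ?_⟩ <;>
    linarith [i.cast_nonneg (α := ℝ), j.cast_nonneg (α := ℝ)]

theorem prismPoint_mem {n x y a : ℕ} (hx : x + a ≤ n) (hy : y ≤ n) :
    prismPoint n x y a ∈ A₂ n ∩ lattice n := by
  refine ⟨?_, prismPoint_mem_lattice n x y a⟩
  rw [prismPoint, mem_A₂]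
  rify at hx hy
  refine ⟨x.cast_nonneg, y.cast_nonneg, hy, ?_, ?_⟩ <;> linarith [a.cast_nonneg (α := ℝ)]

theorem add_one_mem_interior_Ici (x : ℕ) : (x : ℝ) + 1 ∈ interior (Set.Ici (0 : ℝ)) := by
  rw [interior_Ici]
  exact Nat.cast_add_one_pos (α := ℝ) x

theorem add_one_mem_interior_Icc {n y : ℕ} (hy : y + 2 ≤ n) :
    (y : ℝ) + 1 ∈ interior (Set.Icc (0 : ℝ) n) := by
  rw [interior_Icc]
  exact ⟨Nat.cast_add_one_pos (α := ℝ) y, by exact_mod_cast (show y + 1 < n by omega)⟩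

variable {R K : Type*} [PosSemifield R] [Field K] (ν : R →* K)

theorem isHalfOctSolution_of_isRecurrent {n : ℕ} {f : State n (A₁ n) R}
    (hadd : ∀ a b, ν (a + b) = ν a + ν b) (hf : IsRecurrent (n : ℤ) Set.univ (Set.Ici 0) (A₁ n) f) :
    IsHalfOctSolution n fun i j y => extendOne ν f (halfOctPoint n i j y) where
  inner i j y hi hj := by
    rw [mul_comm (extendOne ν f (halfOctPoint n i j (y + 1)))]
    apply hf.extendOne_inner ν hadd (x := (i : ℝ) + j + y + 2 - n) (t := (i : ℝ) - j) (by simp)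
      (add_one_mem_interior_Ici y)
    case hu | hd | he | hw | hk | hl => exact halfOctPoint_mem (by omega) (by omega)
    all_goals ext <;> simp only [halfOctPoint] <;> push_cast <;> ring
  wall i j hi hj := by
    rw [mul_comm (extendOne ν f (halfOctPoint n i j 0))]
    apply hf.extendOne_wall_y ν (x := (i : ℝ) + j + 1 - n) (y := 0) (t := (i : ℝ) - j) (by simp)
      (by simp)
    case hu | hd | he | hw => exact halfOctPoint_mem (by omega) (by omega)
    all_goals ext <;> simp only [halfOctPoint] <;> push_cast <;> ring

theorem isPrismSolution_of_isRecurrent {n : ℕ} {f : State n (A₂ n) R}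
    (hadd : ∀ a b, ν (a + b) = ν a + ν b)
    (hf : IsRecurrent (n : ℤ) (Set.Ici 0) (Set.Icc 0 (n : ℝ)) (A₂ n) f) :
    IsPrismSolution n fun x y a => extendOne ν f (prismPoint n x y a) where
  inner x y a hx hy := by
    apply hf.extendOne_inner ν hadd (t := (x : ℝ) + y + 2 * a + 3 - n) (add_one_mem_interior_Ici x)
      (add_one_mem_interior_Icc hy)
    case hu | hd | he | hw | hk | hl => exact prismPoint_mem (by omega) (by omega)
    all_goals ext <;> simp only [prismPoint] <;> push_cast <;> ring
  wall_bot x a hx := by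
    apply hf.extendOne_wall_y ν (y := 0) (t := (x : ℝ) + 2 * a + 2 - n) (add_one_mem_interior_Ici x)
      (by simp)
    case hu | hd | he | hw => exact prismPoint_mem (by omega) (by omega)
    all_goals ext <;> simp only [prismPoint] <;> push_cast <;> ring
  wall_top x a hx := by
    apply hf.extendOne_wall_y ν (y := n) (t := (x : ℝ) + 2 * a + 2) (add_one_mem_interior_Ici x)
      (by simp)
    case hu | hd | he | hw => exact prismPoint_mem (by omega) (by omega)
    all_goals ext <;> simp only [prismPoint] <;> push_cast <;> ring
  wall_x y a ha hy := by
    apply hf.extendOne_wall_x ν (x := 0) (t := (y : ℝ) + 2 * a + 2 - n) (by simp)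
      (add_one_mem_interior_Icc hy)
    case hu | hd | hk | hl => exact prismPoint_mem (by omega) (by omega)
    all_goals ext <;> simp only [prismPoint] <;> push_cast <;> ring
  corner_bot a ha := by
    have one_le_n : 1 ≤ n := by omega
    apply hf.extendOne_corner ν (x := 0) (y := 0) (t := 2 * (a : ℝ) + 1 - n) 1 1 (by simp) (by simp)
      (.inl rfl) (.inl rfl) (by simp) (by simpa using one_le_n)
    case hu | hd | he | hk => exact prismPoint_mem (by omega) (by omega)
    all_goals ext <;> simp only [prismPoint] <;> push_cast <;> ring
  corner_top a ha := by
    have one_le_n : 1 ≤ n := by omega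
    apply hf.extendOne_corner ν (x := 0) (y := n) (t := 2 * (a : ℝ) + 1) 1 (-1) (by simp) (by simp)
      (.inl rfl) (.inr rfl) (by simp) (by simpa using one_le_n)
    case hu | hd | he | hk => exact prismPoint_mem (by omega) (by omega)
    all_goals ext <;> simp only [prismPoint, Nat.cast_sub one_le_n] <;> push_cast <;> ring

end Coordinates

/-! ### Equivalence of the recurrences -/

section Boundaries

theorem halfOctPoint_mem_S₁_left {n x y : ℕ} (h : x + y ≤ n) :
    halfOctPoint n 0 x y ∈ S₁ n ∩ lattice n := by
  refine ⟨?_, halfOctPoint_mem_lattice n 0 x y⟩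
  rify at h
  rw [halfOctPoint, mem_S₁, Nat.cast_zero, zero_add, abs_of_nonpos (by linarith)]
  exact ⟨y.cast_nonneg, by simp, by ring⟩

theorem sFun_halfOctPoint_left {n x y : ℕ} (h : x + y ≤ n) :
    sFun (halfOctPoint n 0 x y) = prismPoint n x y 0 := by
  rify at h
  rw [halfOctPoint, Nat.cast_zero, zero_add, sFun_of_nonpos (by linarith)]
  ext <;> simp only [prismPoint] <;> push_cast <;> ring

theorem halfOctPoint_right {n i x : ℕ} (hx : x ≤ n) :
    halfOctPoint n i x (n - x) = ((i : ℝ), (n : ℝ) - x, (i : ℝ) - x) := by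
  rw [halfOctPoint, Nat.cast_sub hx]
  ring_nf

theorem halfOctPoint_mem_S₁_right {n i x : ℕ} (hx : x ≤ n) (hi : i ≤ x) :
    halfOctPoint n i x (n - x) ∈ S₁ n ∩ lattice n := by
  refine ⟨?_, halfOctPoint_mem_lattice n i x (n - x)⟩
  rify at hx hi
  rw [halfOctPoint_right (by exact_mod_cast hx), mem_S₁, abs_of_nonneg i.cast_nonneg]
  exact ⟨by linarith, by linarith, by ring⟩

theorem sFun_halfOctPoint_right {n i x y : ℕ} (hx : x ≤ n) (h : x + y = n + i) :
    sFun (halfOctPoint n i x (n - x)) = prismPoint n x y 0 := by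
  rify at h
  rw [halfOctPoint_right hx, sFun_of_nonneg i.cast_nonneg]
  ext <;> simp only [prismPoint] <;> push_cast <;> linarith

theorem lowerMatch_of_eqOn {K : Type*} {n : ℕ} {Φ₁ Φ₂ : ℝ × ℝ × ℝ → K}
    (h : Set.EqOn (Φ₂ ∘ sFun) Φ₁ (S₁ n ∩ lattice n)) :
    LowerMatch n (fun i j y => Φ₁ (halfOctPoint n i j y))
      fun x y a => Φ₂ (prismPoint n x y a) where
  left x y hxy := by
    rw [← h (halfOctPoint_mem_S₁_left hxy), Function.comp_apply, sFun_halfOctPoint_left hxy]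
  right x y i hx hy hxy := by
    rw [← h (halfOctPoint_mem_S₁_right hx (by omega)), Function.comp_apply,
      sFun_halfOctPoint_right hx hxy]

theorem UpperMatch.eqOn {K : Type*} {n : ℕ} {Φ₁ Φ₂ : ℝ × ℝ × ℝ → K}
    (h : UpperMatch n (fun i j y => Φ₁ (halfOctPoint n i j y))
      fun x y a => Φ₂ (prismPoint n x y a)) :
    Set.EqOn (Φ₂ ∘ sFun') Φ₁ (S₁' n ∩ lattice n) := by
  rintro _ ⟨hp, x, y, t, rfl, -⟩
  rw [mem_S₁'] at hp
  norm_cast at hp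
  obtain ⟨hy, ht, hn⟩ := hp
  lift y to ℕ using hy
  lift t to ℕ using ht
  rcases le_total 0 x with hx | hx
  · rw [abs_of_nonneg hx] at hn
    lift x to ℕ using hx
    obtain rfl : n = x + y + t := by omega
    convert h.right t (x + t) (by omega) (by omega) using 2
    · rw [Function.comp_apply, sFun'_of_nonneg (by simp), show x + y + t - t = x + y by omega]
      congr 1
      ext <;> simp only [prismPoint] <;> push_cast <;> ring
    · rw [show x + y + t - (x + t) = y by omega, show x + t - t = x by omega]
      ext <;> simp only [halfOctPoint] <;> push_cast <;> ring
  · obtain ⟨z, rfl⟩ : ∃ z : ℕ, x = -z := ⟨x.natAbs, by omega⟩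
    obtain rfl : n = z + y + t := by
      rw [abs_of_nonpos hx] at hn
      omega
    convert h.left (z + t) t (by omega) (by omega) using 2
    · rw [Function.comp_apply, sFun'_of_nonpos (by simp), show z + y + t - (z + t) = y by omega]
      congr 1
      ext <;> simp only [prismPoint] <;> push_cast <;> ring
    · rw [show z + y + t - (z + t) = y by omega]
      ext <;> simp only [halfOctPoint] <;> push_cast <;> ring

end Boundaries

section Equivalence

variable {n : ℕ}

/-- The point `(-n, 0, 0)` of `S₁`. -/
def leftVertex (n : ℕ) : ↥(S₁ n ∩ lattice n) :=
  ⟨halfOctPoint n 0 0 0, halfOctPoint_mem_S₁_left n.zero_le⟩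

/-- The point `(0, 0, -n)` of `S₁`. -/
def bottomVertex (n : ℕ) : ↥(S₁ n ∩ lattice n) :=
  ⟨halfOctPoint n 0 n 0, halfOctPoint_mem_S₁_left le_rfl⟩

theorem pullback_mul_leftVertex_of_isRecurrent {R K : Type*} [PosSemifield R] [Field K]
    {ν : R →* K} (hadd : ∀ a b, ν (a + b) = ν a + ν b) (hinj : Function.Injective ν)
    {f₁ : State n (A₁ n) R} {f₂ : State n (A₂ n) R}
    (h₁ : IsRecurrent (n : ℤ) Set.univ (Set.Ici 0) (A₁ n) f₁)
    (h₂ : IsRecurrent (n : ℤ) (Set.Ici 0) (Set.Icc 0 (n : ℝ)) (A₂ n) f₂)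
    (hlow : pullback (s n) (s_lattice n) (restrict (S₂_subset n) f₂) =
      restrict (S₁_subset n) f₁) (p : ↥(S₁' n ∩ lattice n)) :
    pullback (s' n) (s'_lattice n) (restrict (S₂'_subset n) f₂) p *
        restrict (S₁_subset n) f₁ (leftVertex n) =
      restrict (S₁'_subset n) f₁ p * restrict (S₁_subset n) f₁ (bottomVertex n) := by
  have sFun_mem {q} (hq : q ∈ S₁ n ∩ lattice n) : sFun q ∈ A₂ n ∩ lattice n :=
    ⟨S₂_subset n (s n ⟨q, hq.1⟩).2, s_lattice n ⟨q, hq.1⟩ hq.2⟩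
  have sFun'_mem : sFun' p ∈ A₂ n ∩ lattice n :=
    ⟨S₂'_subset n (s' n ⟨p, p.2.1⟩).2, s'_lattice n ⟨p, p.2.1⟩ p.2.2⟩
  have lower_eqOn : Set.EqOn (extendOne ν f₂ ∘ sFun) (extendOne ν f₁) (S₁ n ∩ lattice n) := by
    intro q hq
    rw [Function.comp_apply, extendOne_of_mem ν f₂ (sFun_mem hq),
      extendOne_of_mem ν f₁ ⟨S₁_subset n hq.1, hq.2⟩]
    exact congrArg ν (congrFun hlow ⟨q, hq⟩)
  have upper_eqOn := UpperMatch.eqOn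
    (Φ₁ := fun q => extendOne ν f₁ q * extendOne ν f₁ (bottomVertex n))
    (Φ₂ := fun q => extendOne ν f₂ q * extendOne ν f₁ (leftVertex n))
    (upperMatch_of_lowerMatch (isHalfOctSolution_of_isRecurrent ν hadd h₁)
      (isPrismSolution_of_isRecurrent ν hadd h₂) (fun _ _ _ => extendOne_ne_zero ν f₁ _)
      (fun _ _ _ => extendOne_ne_zero ν f₂ _) (lowerMatch_of_eqOn lower_eqOn))
  have upper_eq := upper_eqOn p.2
  simp only [Function.comp_apply] at upper_eq
  rw [extendOne_of_mem ν f₂ sFun'_mem, extendOne_of_mem ν f₁ ⟨S₁'_subset n p.2.1, p.2.2⟩,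
    extendOne_of_mem ν f₁ ⟨S₁_subset n (leftVertex n).2.1, (leftVertex n).2.2⟩,
    extendOne_of_mem ν f₁ ⟨S₁_subset n (bottomVertex n).2.1, (bottomVertex n).2.2⟩,
    ← map_mul, ← map_mul] at upper_eq
  exact hinj upper_eq

theorem pullback_evolution_mul_leftVertex {F : Type*} [PosSemifield F] (g : State n (S₂ n) F)
    (p : ↥(S₁' n ∩ lattice n)) :
    pullback (s' n) (s'_lattice n) (evolution (S₂'_subset n) (wellPosed₂ n F) g) p *
        pullback (s n) (s_lattice n) g (leftVertex n) =
      evolution (S₁'_subset n) (wellPosed₁ n F) (pullback (s n) (s_lattice n) g) p *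
        pullback (s n) (s_lattice n) g (bottomVertex n) := by
  let R := valueSubgroup g
  let π : R →* F := valueSubgroup.value g
  let generic : State n (S₂ n) R := valueSubgroup.coord g
  obtain ⟨recurrent₂, extends₂⟩ := (wellPosed₂ n R generic).choose_spec.1
  obtain ⟨recurrent₁, extends₁⟩ :=
    (wellPosed₁ n R (pullback (s n) (s_lattice n) generic)).choose_spec.1
  have generic_eq := pullback_mul_leftVertex_of_isRecurrent
    (valueSubgroup.toRationalFunctions_add g) (valueSubgroup.toRationalFunctions_injective g)
    recurrent₁ recurrent₂ (by rw [extends₁, extends₂]) p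
  rw [extends₁] at generic_eq
  have map₂ := evolution_map π (valueSubgroup.value_add g) (S₂'_subset n) (wellPosed₂ n F)
    (wellPosed₂ n R) generic
  have map₁ := evolution_map π (valueSubgroup.value_add g) (S₁'_subset n) (wellPosed₁ n F)
    (wellPosed₁ n R) (pullback (s n) (s_lattice n) generic)
  have value_eq := congrArg π generic_eq
  rw [map_mul, map_mul] at value_eq
  convert value_eq using 2
  exacts [congrFun map₂ _, rfl, congrFun map₁ p, rfl]

end Equivalence

end OctRec

/-- The recurrences in the half-octahedron `A₁` and in the domain `A₂` are equivalent up to scaling: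
`s'* ∘ φ̄₂ = φ̄₁ ∘ s*` as maps from the projectivized states of `S₂` to those of `S₁'`. -/
theorem mainTheorem4 (n : ℕ) (hn : 0 < n) (F : Type*) [OctRec.PosSemifield F] :
    OctRec.sPull' n F ∘ OctRec.projPhi₂ n F = OctRec.projPhi₁ n F ∘ OctRec.sPull n F := by
  funext q
  induction q using Quotient.ind with
  | _ g =>
    let g₁ := OctRec.pullback (OctRec.s n) (OctRec.s_lattice n) g
    refine Quotient.sound
      ⟨g₁ (OctRec.bottomVertex n) / g₁ (OctRec.leftVertex n), funext fun p => ?_⟩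
    change _ / _ * OctRec.evolution (OctRec.S₁'_subset n) (OctRec.wellPosed₁ n F) g₁ p = _
    rw [div_mul_eq_mul_div, div_eq_iff_eq_mul, mul_comm]
    exact (OctRec.pullback_evolution_mul_leftVertex g p).symm
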